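/- \textbf{Conventions.} Put $\{x\}=x-x^{-1}$, $D=\{A\}/\{q\}$, $\phi=A\{q\}$, $\bar\phi=-A^{-1}\{q\}$. For an oriented tangle diagram and $N\ge 1$ consider the operator obtained from the fundamental $R$-matrix of $U_q(\mathfrak{sl}_N)$, normalised to have eigenvalues $q,-q^{-1}$, in the vertical (blackboard) framing, so that a simple closed curve has value $[N]=\{q^N\}/\{q\}$. For a closed diagram, $P(q,A)\in\mathbb Q(q)[A^{\pm1}]$ is the Laurent polynomial in $A$ whose value at $A=q^N$ is this invariant for all $N\ge1$, and the HOMFLY polynomial is $H=A^{-w}P$, where $w$ is the writhe (so $H=D$ for the unknot). An identity $T=\|+x\cdot{\smile\atop\frown}$ between tangles with four ends, $x\in\mathbb Q(q)[A^{\pm1}]$, means that it holds for the operators at $A=q^N$ for all $N\ge 1$. The (horizontal) antiparallel lock consists of two positive crossings, one above the other, of a strand directed down (left) with a strand directed up (right); the opposite lock has two negative crossings. For $n\in\mathbb Z$ the vertical chain $C_n$ is a stack of $n$ locks on top of each other (of $-n$ opposite locks if $n<0$). Joining the upper left end of $C_n$ to its lower left end and the upper right end to the lower right end gives the antiparallel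 torus link $APT[2,2n]$; joining its two upper ends and its two lower ends gives the open closure (an unknot). \textbf{Part 1 (planar calculus).} Let $\mathbb K$ be a field and $f,f',\delta\in\mathbb K$ with $\delta\ne0$ and $f+f'+ff'\delta=0$. Resolve every lock as $\|+f\cdot{\smile\atop\frown}$ and every opposite lock as $\|+f'\cdot{\smile\atop\frown}$, and replace each closed cycle by the factor $\delta$. Then $C_n=\|+\Phi_n\cdot{\smile\atop\frown}$ for all $n\in\mathbb Z$, with a unique $\Phi_n\in\mathbb K$, and for all $n,m\in\mathbb Z$ $$\Phi_1=f,\quad \Phi_0=0,\quad \Phi_{-1}=f',\quad \Phi_{n+m}=\Phi_n+\Phi_m+\Phi_n\Phi_m\delta,\quad \Phi_n=\frac{(1+f\delta)^n-1}{\delta},\quad \Phi_{-n}=\frac{(1+f'\delta)^n-1}{\delta}.$$ The polynomials of $APT[2,2n]$ and of the open closure (the sums over all resolutions of $\delta^{a}f^{b}f'^{\,c}$, where $a$ is the number of cycles and $b$, $c$ are the numbers of locks and of opposite locks resolved as ${\smile\atop\frown}$) are $\delta(\delta+\Phi_n)$ and $\delta(1+\delta\Phi_n)$. \textbf{Part 2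 (HOMFLY).} One has $\phi+\bar\phi+\phi\bar\phi D=0$. For all $n\in\mathbb Z$ there is a unique $\Phi_n$ with $C_n=\|+\Phi_n\cdot{\smile\atop\frown}$ as tangles, and for all $n,m\in\mathbb Z$ $$\Phi_1=\phi,\quad \Phi_0=0,\quad \Phi_{-1}=\bar\phi,\quad \Phi_{n+m}=\Phi_n+\Phi_m+\Phi_n\Phi_mD,\quad \Phi_n=\frac{(1+\phi D)^n-1}{D},\quad \Phi_{-n}=\frac{(1+\bar\phi D)^n-1}{D}.$$ In the vertical framing $P^{APT[2,2n]}=D(D+\Phi_n)$ and the open closure has $P=D(1+D\Phi_n)$. The HOMFLY polynomials exist, are unique, and are $$H^{APT[2,2n]}=A^{-2n}\bigl(D^2-1+(1+\phi D)^n\bigr),\qquad H^{\text{open closure}}=A^{-2n}D(1+\phi D)^n=D.$$ The cyclotomic function of $APT[2,2n]$, that is, the Laurent polynomial $F\in\mathbb Z[q^{\pm1},A^{\pm1}]$ with $$H^{APT[2,2n]}=D^2\Bigl(1+\frac{\{Aq\}\{A/q\}}{\{A\}}\,F\Bigr),$$ exists, is unique, and is $F=\dfrac{A^{-2n}-1}{\{A\}}$.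 -/

import Mathlib

namespace AntiparallelChain

/-! ### Oriented tangle diagrams -/

/-- Boundary words of oriented tangle diagrams, with parentheses: `up` and `down` are points at
which the strand is directed upwards, respectively downwards. -/
inductive Ob : Type
  | unit : Ob
  | up : Ob
  | down : Ob
  | tensor : Ob → Ob → Ob

open Ob

/-- Oriented tangle diagrams in the plane, read from bottom to top. `cross true` is the positive
crossing of two upward strands (the strand from bottom left to top right passes over),
`cross false` is the negative one (the strand from bottom right to top left passes over).
`cupUD` is the cup whose left leg is directed up and whose right leg is directed down, and
likewise for `cupDU`, `capUD`, `capDU`. The constructors from `assoc` to `runitInv`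
only move parentheses and change nothing in the drawing. -/
inductive Diag : Ob → Ob → Type
  | id (a : Ob) : Diag a a
  | comp {a b c : Ob} : Diag a b → Diag b c → Diag a c
  | tensor {a b c d : Ob} : Diag a b → Diag c d → Diag (tensor a c) (tensor b d)
  | cross (positive : Bool) : Diag (tensor up up) (tensor up up)
  | cupUD : Diag unit (tensor up down)
  | cupDU : Diag unit (tensor down up)
  | capUD : Diag (tensor up down) unit
  | capDU : Diag (tensor down up) unit
  | assoc (a b c : Ob) : Diag (tensor (tensor a b) c) (tensor a (tensor b c))
  | assocInv (a b c : Ob) : Diag (tensor a (tensor b c)) (tensor (tensor a b) c)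
  | lunit (a : Ob) : Diag (tensor unit a) a
  | lunitInv (a : Ob) : Diag a (tensor unit a)
  | runit (a : Ob) : Diag (tensor a unit) a
  | runitInv (a : Ob) : Diag a (tensor a unit)

/-- The writhe: the number of positive crossings minus the number of negative ones. Rotating a
crossing does not change its sign. -/
def writhe : {a b : Ob} → Diag a b → ℤ
  | _, _, .comp f g => writhe f + writhe g
  | _, _, .tensor f g => writhe f + writhe g
  | _, _, .cross true => 1
  | _, _, .cross false => -1
  | _, _, _ => 0

/-! ### The Reshetikhin–Turaev evaluation for the fundamental representation of `U_q(sl_N)` -/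

/-- Basis labels of the tensor product attached to a boundary word. -/
def State (N : ℕ) : Ob → Type
  | .unit => Unit
  | .up => Fin N
  | .down => Fin N
  | .tensor a b => State N a × State N b

instance instFintypeState (N : ℕ) : (a : Ob) → Fintype (State N a)
  | .unit => inferInstanceAs (Fintype Unit)
  | .up => inferInstanceAs (Fintype (Fin N))
  | .down => inferInstanceAs (Fintype (Fin N))
  | .tensor a b =>
    letI := instFintypeState N a
    letI := instFintypeState N b
    inferInstanceAs (Fintype (State N a × State N b))

instance instDecidableEqState (N : ℕ) : (a : Ob) → DecidableEq (State N a)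
  | .unit => inferInstanceAs (DecidableEq Unit)
  | .up => inferInstanceAs (DecidableEq (Fin N))
  | .down => inferInstanceAs (DecidableEq (Fin N))
  | .tensor a b =>
    letI := instDecidableEqState N a
    letI := instDecidableEqState N b
    inferInstanceAs (DecidableEq (State N a × State N b))

/-- The fundamental `R`-matrix: `e_a ⊗ e_a ↦ q e_a ⊗ e_a`, and
`e_a ⊗ e_b ↦ e_b ⊗ e_a + (q - q⁻¹) e_a ⊗ e_b` for `a < b`, `e_a ⊗ e_b ↦ e_b ⊗ e_a` for `a > b`.
Its eigenvalues are `q` and `-q⁻¹`. -/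
def rMatrix {K : Type*} [Field K] (q : K) (N : ℕ) : Matrix (Fin N × Fin N) (Fin N × Fin N) K :=
  Matrix.of fun y x =>
    if x.1 = x.2 then (if y = x then q else 0)
    else (if y = (x.2, x.1) then 1 else 0) +
      (if y = x ∧ x.1 < x.2 then q - q⁻¹ else 0)

/-- The inverse of the `R`-matrix. -/
def rMatrixInv {K : Type*} [Field K] (q : K) (N : ℕ) : Matrix (Fin N × Fin N) (Fin N × Fin N) K :=
  Matrix.of fun y x =>
    if x.1 = x.2 then (if y = x then q⁻¹ else 0)
    else (if y = (x.2, x.1) then 1 else 0) -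
      (if y = x ∧ x.2 < x.1 then q - q⁻¹ else 0)

/-- The weights `q^{1-N}, q^{3-N}, …, q^{N-1}` of the quantum trace. -/
def weight {K : Type*} [Field K] (q : K) (N : ℕ) (i : Fin N) : K :=
  q ^ (2 * (i : ℤ) + 1 - (N : ℤ))

/-- The matrix of a map of basis labels. -/
def ofMap {K : Type*} [Field K] {S T : Type} [DecidableEq T] (e : S → T) : Matrix T S K :=
  Matrix.of fun y x => if y = e x then 1 else 0

/-- The operator of a tangle diagram (in the blackboard, or "vertical", framing). -/
def rt {K : Type*} [Field K] (q : K) (N : ℕ) :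
    {a b : Ob} → Diag a b → Matrix (State N b) (State N a) K
  | _, _, .id _ => 1
  | _, _, .comp f g => rt q N g * rt q N f
  | _, _, .tensor f g => Matrix.kroneckerMap (· * ·) (rt q N f) (rt q N g)
  | _, _, .cross true => rMatrix q N
  | _, _, .cross false => rMatrixInv q N
  | _, _, .cupUD => Matrix.of fun (y : Fin N × Fin N) (_ : Unit) => if y.1 = y.2 then 1 else 0
  | _, _, .cupDU => Matrix.of fun (y : Fin N × Fin N) (_ : Unit) =>
      if y.1 = y.2 then (weight q N y.1)⁻¹ else 0
  | _, _, .capUD => Matrix.of fun (_ : Unit) (x : Fin N × Fin N) =>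
      if x.1 = x.2 then weight q N x.1 else 0
  | _, _, .capDU => Matrix.of fun (_ : Unit) (x : Fin N × Fin N) => if x.1 = x.2 then 1 else 0
  | _, _, .assoc a b c =>
      ofMap fun x : (State N a × State N b) × State N c =>
        ((x.1.1, (x.1.2, x.2)) : State N (tensor a (tensor b c)))
  | _, _, .assocInv a b c =>
      ofMap fun x : State N a × (State N b × State N c) =>
        (((x.1, x.2.1), x.2.2) : State N (tensor (tensor a b) c))
  | _, _, .lunit a => ofMap fun x : Unit × State N a => x.2
  | _, _, .lunitInv a => ofMap fun x : State N a => (((), x) : State N (tensor unit a))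
  | _, _, .runit a => ofMap fun x : State N a × Unit => x.1
  | _, _, .runitInv a => ofMap fun x : State N a => ((x, ()) : State N (tensor a unit))

/-! ### Locks, chains and their closures as tangle diagrams -/

/-- Apply `f` to the two middle strands of four. -/
def middle (a : Ob) {b c b' c' : Ob} (d : Ob) (f : Diag (tensor b c) (tensor b' c')) :
    Diag (tensor (tensor a b) (tensor c d)) (tensor (tensor a b') (tensor c' d)) :=
  (Diag.assoc a b (tensor c d)).comp <|
  ((Diag.id a).tensor (Diag.assocInv b c d)).comp <|
  ((Diag.id a).tensor (f.tensor (Diag.id d))).comp <|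
  ((Diag.id a).tensor (Diag.assoc b' c' d)).comp
  (Diag.assocInv a b' (tensor c' d))

/-- The crossing of the given sign, rotated by a quarter turn: the left strand is directed
downwards and the right strand upwards at the bottom. -/
def crossDU (positive : Bool) : Diag (tensor down up) (tensor up down) :=
  (Diag.runitInv (tensor down up)).comp <|
  ((Diag.id (tensor down up)).tensor Diag.cupUD).comp <|
  (middle down down (Diag.cross positive)).comp <|
  (Diag.capDU.tensor (Diag.id (tensor up down))).comp
  (Diag.lunit (tensor up down))

/-- The crossing of the given sign, rotated by a quarter turn the other way: the left strand is
directed upwards and the right strand downwards at the bottom. -/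
def crossUD (positive : Bool) : Diag (tensor up down) (tensor down up) :=
  (Diag.lunitInv (tensor up down)).comp <|
  (Diag.cupDU.tensor (Diag.id (tensor up down))).comp <|
  (middle down down (Diag.cross positive)).comp <|
  ((Diag.id (tensor down up)).tensor Diag.capUD).comp
  (Diag.runit (tensor down up))

/-- The horizontal antiparallel lock (`true`) and its opposite (`false`): two crossings of the
same sign, one above the other, of a strand directed down with a strand directed up. -/
def lock (positive : Bool) : Diag (tensor down up) (tensor down up) :=
  (crossDU positive).comp (crossUD positive)

/-- `n` copies of a tangle on top of each other. -/
def iter {a : Ob} (f : Diag a a) : ℕ → Diag a a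
  | 0 => Diag.id a
  | n + 1 => (iter f n).comp f

/-- The vertical chain of `n` antiparallel locks; for `n < 0` it consists of `-n` opposite locks. -/
def chain (n : ℤ) : Diag (tensor down up) (tensor down up) :=
  iter (lock (decide (0 ≤ n))) n.natAbs

/-- Two vertical antiparallel strands. -/
def parallelStrands : Diag (tensor down up) (tensor down up) := Diag.id (tensor down up)

/-- The cup-cap tangle. -/
def cupCap : Diag (tensor down up) (tensor down up) := Diag.capDU.comp Diag.cupDU

/-- The antiparallel torus link `APT[2,2n]`: the upper left end of the chain is joined to the lower
left end, and the upper right end to the lower right end. -/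
def apt (n : ℤ) : Diag unit unit :=
  (Diag.lunitInv unit).comp <|
  (Diag.cupUD.tensor Diag.cupUD).comp <|
  (middle up down (chain n)).comp <|
  (Diag.capUD.tensor Diag.capUD).comp
  (Diag.lunit unit)

/-- The open closure: the two upper ends of the chain are joined, and so are the two lower ends. -/
def openClosure (n : ℤ) : Diag unit unit :=
  Diag.cupDU.comp ((chain n).comp Diag.capDU)

/-! ### Two-variable polynomials -/

noncomputable section

/-- Laurent polynomials in `A` over the field `ℚ(q)`. -/
abbrev Laurent : Type := LaurentPolynomial (RatFunc ℚ)

/-- The field of rational functions in `q` and `A`. -/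
abbrev RatQA : Type := FractionRing Laurent

def q : RatQA := algebraMap Laurent RatQA (LaurentPolynomial.C RatFunc.X)

def A : RatQA := algebraMap Laurent RatQA (LaurentPolynomial.T 1)

/-- `{x} = x - x⁻¹`. -/
def brace (x : RatQA) : RatQA := x - x⁻¹

def D : RatQA := brace A / brace q

def φ : RatQA := A * brace q

def φbar : RatQA := -A⁻¹ * brace q

/-- The substitution `A = q^N`. -/
def spec (N : ℕ) : Laurent →+* RatFunc ℚ :=
  LaurentPolynomial.eval₂ (RingHom.id (RatFunc ℚ))
    ((Units.mk0 (RatFunc.X : RatFunc ℚ) RatFunc.X_ne_zero) ^ N)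

/-- `P` is the HOMFLY polynomial, in the vertical framing, of a closed diagram: the Laurent
polynomial in `A` over `ℚ(q)` whose value at `A = q^N` is the `U_q(sl_N)` invariant for all
`N ≥ 1`. -/
def IsFramedHomfly (d : Diag unit unit) (P : RatQA) : Prop :=
  ∃ p : Laurent, algebraMap Laurent RatQA p = P ∧
    ∀ N : ℕ, 1 ≤ N → spec N p = rt (RatFunc.X : RatFunc ℚ) N d () ()

/-- `H` is the HOMFLY polynomial (in the topological framing, with value `D` on the unknot) of the
link given by a closed diagram. -/
def IsHomfly (d : Diag unit unit) (H : RatQA) : Prop :=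
  ∃ P : RatQA, IsFramedHomfly d P ∧ H = A ^ (-writhe d) * P

/-- `x` is the coefficient in the decomposition `T = ‖ + x · cup-cap` of a tangle. -/
def IsCupCapCoeff (T : Diag (tensor down up) (tensor down up)) (x : RatQA) : Prop :=
  ∃ p : Laurent, algebraMap Laurent RatQA p = x ∧
    ∀ N : ℕ, 1 ≤ N → rt (RatFunc.X : RatFunc ℚ) N T =
      rt RatFunc.X N parallelStrands + spec N p • rt RatFunc.X N cupCap

/-- `F` is the cyclotomic function of a `c`-component link with HOMFLY polynomial `H`: the Laurent
polynomial in `q`, `A` with `H = D^c (1 + {Aq}{A/q} {A}^{1-c} F)`. -/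
def IsCyclotomicFunction (c : ℕ) (H F : RatQA) : Prop :=
  F ∈ Algebra.adjoin ℤ ({q, q⁻¹, A, A⁻¹} : Set RatQA) ∧
    H = D ^ c * (1 + brace (A * q) * brace (A / q) / brace A ^ ((c : ℤ) - 1) * F)

/-- A Laurent polynomial in `A` is determined by its values at `A = q^N`, `N ≥ 1`. -/
theorem eq_of_spec_eq {p p' : Laurent} (h : ∀ N : ℕ, 1 ≤ N → spec N p = spec N p') : p = p' := by
  have hX : ∀ m n : ℕ, (RatFunc.X : RatFunc ℚ) ^ m = RatFunc.X ^ n → m = n := by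
    intro m n hmn
    rw [← RatFunc.algebraMap_X, ← map_pow, ← map_pow] at hmn
    have := congrArg Polynomial.natDegree (RatFunc.algebraMap_injective ℚ hmn)
    simpa using this
  rw [← sub_eq_zero]
  obtain ⟨n, f, hf⟩ := LaurentPolynomial.exists_T_pow (p - p')
  have hroot : ∀ N : ℕ, 1 ≤ N → f.eval (RatFunc.X ^ N) = 0 := by
    intro N hN
    have h1 := congrArg (spec N) hf
    rw [map_mul, map_sub, h N hN, sub_self, zero_mul] at h1
    simpa [spec, LaurentPolynomial.eval₂_toLaurent, Polynomial.eval₂_id] using h1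
  have hf0 : f = 0 := by
    refine Polynomial.eq_zero_of_infinite_isRoot f ?_
    refine Set.infinite_of_injective_forall_mem (f := fun N : ℕ => RatFunc.X ^ (N + 1)) ?_ ?_
    · intro a b hab
      exact Nat.succ_injective (hX _ _ hab)
    · intro N
      exact hroot (N + 1) (by omega)
  rw [hf0, map_zero] at hf
  have h2 : (p - p') * LaurentPolynomial.T n * LaurentPolynomial.T (-(n : ℤ)) = 0 := by
    rw [← hf, zero_mul]
  rwa [mul_assoc, ← LaurentPolynomial.T_add, add_neg_cancel, LaurentPolynomial.T_zero,
    mul_one] at h2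

theorem IsHomfly.unique {d : Diag unit unit} {H H' : RatQA} (h : IsHomfly d H)
    (h' : IsHomfly d H') : H = H' := by
  obtain ⟨P, ⟨p, rfl, hp⟩, rfl⟩ := h
  obtain ⟨P', ⟨p', rfl, hp'⟩, rfl⟩ := h'
  rw [eq_of_spec_eq fun N hN => (hp N hN).trans (hp' N hN).symm]

end

/-! ### Planar calculus of lock diagrams -/

/-- The four ends of a lock, or of a tangle with four ends: (is it at the top?, is it at the
left?). -/
abbrev Corner : Type := Bool × Bool

/-- A tangle diagram made of locks, with the set `B` of external ends, up to planar isotopy.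
`black v` says that `v` is a lock, and not an opposite lock. Every lock is placed so that it is
horizontal, its four legs are the pairs `(v, c)`, and `edge` says to which other leg or external
end each leg or external end is connected. -/
structure LockTangle (B : Type) where
  V : Type
  [fintypeV : Fintype V]
  [decidableEqV : DecidableEq V]
  black : V → Bool
  edge : (V × Corner) ⊕ B → (V × Corner) ⊕ B
  edge_edge : ∀ x, edge (edge x) = x
  edge_ne : ∀ x, edge x ≠ x

attribute [instance] LockTangle.fintypeV LockTangle.decidableEqV

namespace LockTangle

variable {B : Type}

/-- The two planar resolutions of a horizontal lock: `‖` (`false`) and cup-cap (`true`). -/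
def resolve : Bool → Corner → Corner
  | false, c => (!c.1, c.2)
  | true, c => (c.1, !c.2)

/-- Two points are adjacent after resolving the locks as told by `s`. -/
def Adj (T : LockTangle B) (s : T.V → Bool) (x y : (T.V × Corner) ⊕ B) : Prop :=
  y = T.edge x ∨ ∃ v c, x = Sum.inl (v, c) ∧ y = Sum.inl (v, resolve (s v) c)

/-- Two points lie on the same curve of the resolution `s`. -/
def curves (T : LockTangle B) (s : T.V → Bool) : Setoid ((T.V × Corner) ⊕ B) :=
  Relation.EqvGen.setoid (T.Adj s)

/-- Two points lie on the same curve of the resolution `s` after every external end `b` has been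
joined to the external end `g b`. -/
def closedCurves (T : LockTangle B) (g : B → B) (s : T.V → Bool) :
    Setoid ((T.V × Corner) ⊕ B) :=
  Relation.EqvGen.setoid fun x y => T.Adj s x y ∨ ∃ b, x = Sum.inr b ∧ y = Sum.inr (g b)

/-- How the curves of a resolution connect the external ends. -/
def connection (T : LockTangle B) (s : T.V → Bool) : Setoid B :=
  (T.curves s).comap Sum.inr

noncomputable section

/-- The number of closed cycles of a resolution of a tangle. -/
def cycles (T : LockTangle B) (s : T.V → Bool) : ℕ :=
  Nat.card {k : Quotient (T.curves s) // ∀ b : B, k ≠ Quotient.mk _ (Sum.inr b)}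

variable {𝕂 : Type*} [Field 𝕂]

/-- `φ^b φ̄^c`, where `b` locks and `c` opposite locks are resolved as cup-cap. -/
def coeff (T : LockTangle B) (φ φbar : 𝕂) (s : T.V → Bool) : 𝕂 :=
  ∏ v, if s v then (if T.black v then φ else φbar) else 1

/-- The planar decomposition of a lock tangle, as a formal combination of ways to connect the
external ends: the sum over all resolutions, in which each closed cycle contributes `D`. -/
def planar (T : LockTangle B) (φ φbar D : 𝕂) : Setoid B →₀ 𝕂 :=
  ∑ s : T.V → Bool, Finsupp.single (T.connection s) (D ^ T.cycles s * T.coeff φ φbar s)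

/-- The polynomial `∑ D^a φ^b φ̄^c` of the closed lock diagram in which the external ends of `T` are
joined in pairs by `g`. -/
def closedPolynomial (T : LockTangle B) (g : B → B) (φ φbar D : 𝕂) : 𝕂 :=
  ∑ s : T.V → Bool, D ^ Nat.card (Quotient (T.closedCurves g s)) * T.coeff φ φbar s

end

/-- How the legs in a chain of `n` locks (numbered from top to bottom) are connected. -/
def chainEdge (n : ℕ) : (Fin n × Corner) ⊕ Corner → (Fin n × Corner) ⊕ Corner
  | .inl (i, (true, l)) =>
      if 0 < (i : ℕ) then .inl (⟨(i : ℕ) - 1, by omega⟩, (false, l)) else .inr (true, l)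
  | .inl (i, (false, l)) =>
      if h : (i : ℕ) + 1 < n then .inl (⟨(i : ℕ) + 1, h⟩, (true, l)) else .inr (false, l)
  | .inr (true, l) => if h : 0 < n then .inl (⟨0, h⟩, (true, l)) else .inr (false, l)
  | .inr (false, l) =>
      if h : 0 < n then .inl (⟨n - 1, by omega⟩, (false, l)) else .inr (true, l)

/-- The vertical chain of `n` locks (of `-n` opposite locks for `n < 0`) as a lock tangle. -/
def chain (n : ℤ) : LockTangle Corner where
  V := Fin n.natAbs
  black := fun _ => decide (0 ≤ n)
  edge := chainEdge n.natAbs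
  edge_edge := by
    generalize n.natAbs = m
    rintro (⟨i, (_ | _), l⟩ | ⟨(_ | _), l⟩) <;> simp only [chainEdge] <;> split_ifs <;>
      grind [chainEdge]
  edge_ne := by
    generalize n.natAbs = m
    rintro (⟨i, (_ | _), l⟩ | ⟨(_ | _), l⟩) <;> simp only [chainEdge] <;> split_ifs <;> simp

/-- `‖` connects the ends on the same side. -/
def vertical : Setoid Corner := Setoid.ker Prod.snd

/-- Cup-cap connects the ends at the same height. -/
def horizontal : Setoid Corner := Setoid.ker Prod.fst

/-- The closure that joins the upper to the lower ends, which gives `APT[2,2n]`. -/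
def joinSides : Corner → Corner := fun c => (!c.1, c.2)

/-- The open closure, which joins the left to the right ends. -/
def joinHeights : Corner → Corner := fun c => (c.1, !c.2)

end LockTangle

end AntiparallelChain

open AntiparallelChain

namespace AntiparallelChain

namespace LockTangle

/-- The height (the number of locks above) and the side of a leg or external end of a chain of `n`
locks. -/
def gridPoint (n : ℕ) : (Fin n × Corner) ⊕ Corner → ℕ × Bool
  | .inl (i, (true, l)) => (i, l)
  | .inl (i, (false, l)) => (i + 1, l)
  | .inr (true, l) => (0, l)
  | .inr (false, l) => (n, l)

/-- A point of a chain with given height and side. -/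
def gridRep (n h : ℕ) (l : Bool) : (Fin n × Corner) ⊕ Corner :=
  if hh : 0 < h ∧ h ≤ n then .inl (⟨h - 1, by omega⟩, (false, l)) else .inr (true, l)

theorem gridPoint_chainEdge (n : ℕ) (x : (Fin n × Corner) ⊕ Corner) :
    gridPoint n (chainEdge n x) = gridPoint n x := by
  rcases x with ⟨i, (_ | _), l⟩ | ⟨(_ | _), l⟩ <;> simp only [chainEdge] <;> split_ifs <;>
    simp only [gridPoint] <;> grind

theorem eq_or_eq_chainEdge (n : ℕ) {x y : (Fin n × Corner) ⊕ Corner}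
    (h : gridPoint n x = gridPoint n y) : y = x ∨ y = chainEdge n x := by
  rcases x with ⟨i, (_ | _), l⟩ | ⟨(_ | _), l⟩ <;>
  rcases y with ⟨j, (_ | _), l'⟩ | ⟨(_ | _), l'⟩ <;>
  simp only [gridPoint, Prod.mk.injEq, chainEdge] at h ⊢ <;> grind

theorem gridPoint_fst_le (n : ℕ) (x : (Fin n × Corner) ⊕ Corner) : (gridPoint n x).1 ≤ n := by
  rcases x with ⟨i, (_ | _), l⟩ | ⟨(_ | _), l⟩ <;> simp only [gridPoint] <;> omega

theorem gridPoint_gridRep (n h : ℕ) (l : Bool) (hh : h ≤ n) :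
    gridPoint n (gridRep n h l) = (h, l) := by
  unfold gridRep
  split_ifs with h1
  · simp only [gridPoint, Prod.mk.injEq, and_true]; omega
  · simp only [gridPoint, Prod.mk.injEq, and_true]; omega

/-- `s` resolves the `j`-th lock of a chain as cup-cap. -/
def IsCap {n : ℕ} (s : Fin n → Bool) (j : ℕ) : Prop := ∃ h : j < n, s ⟨j, h⟩ = true

open Classical in
/-- The number of locks above height `h` that are resolved as cup-cap. -/
noncomputable def capCount {n : ℕ} (s : Fin n → Bool) (h : ℕ) : ℕ := Nat.count (IsCap s) h

theorem capCount_zero {n : ℕ} (s : Fin n → Bool) : capCount s 0 = 0 := by simp [capCount]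

theorem capCount_succ_of_isCap {n : ℕ} {s : Fin n → Bool} {h : ℕ} (hc : IsCap s h) :
    capCount s (h + 1) = capCount s h + 1 := by simp [capCount, Nat.count_succ, hc]

theorem capCount_succ_of_not_isCap {n : ℕ} {s : Fin n → Bool} {h : ℕ} (hc : ¬ IsCap s h) :
    capCount s (h + 1) = capCount s h := by simp [capCount, Nat.count_succ, hc]

theorem capCount_mono {n : ℕ} (s : Fin n → Bool) : Monotone (capCount s) := by
  classical exact Nat.count_monotone _

theorem exists_capCount_eq {n : ℕ} (s : Fin n → Bool) {h k : ℕ} (hk : k ≤ capCount s h) :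
    ∃ h' ≤ h, capCount s h' = k := by
  induction h with
  | zero => exact ⟨0, le_rfl, by rw [capCount_zero] at hk ⊢; omega⟩
  | succ h ih =>
    by_cases hkh : k ≤ capCount s h
    · obtain ⟨h', h1, h2⟩ := ih hkh
      exact ⟨h', by omega, h2⟩
    · refine ⟨h + 1, le_rfl, ?_⟩
      by_cases hc : IsCap s h
      · rw [capCount_succ_of_isCap hc] at hk ⊢; omega
      · rw [capCount_succ_of_not_isCap hc] at hk ⊢; omega

theorem prod_ite_eq_pow_capCount {n : ℕ} (s : Fin n → Bool) {M : Type*} [CommMonoid M] (x : M) :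
    ∏ v, (if s v then x else 1) = x ^ capCount s n := by
  classical
  have h1 : ∀ m ≤ n, ∏ i ∈ Finset.range m, (if IsCap s i then x else 1) = x ^ capCount s m := by
    intro m
    induction m with
    | zero => simp [capCount_zero]
    | succ m ih =>
      intro hm
      rw [Finset.prod_range_succ, ih (by omega)]
      by_cases hc : IsCap s m
      · rw [capCount_succ_of_isCap hc, if_pos hc, pow_succ]
      · rw [capCount_succ_of_not_isCap hc, if_neg hc, mul_one]
  rw [← h1 n le_rfl, ← Fin.prod_univ_eq_prod_range (fun i => if IsCap s i then x else 1)]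
  refine Finset.prod_congr rfl fun v _ => ?_
  simp [IsCap]

theorem capCount_eq_zero_iff {n : ℕ} (s : Fin n → Bool) :
    capCount s n = 0 ↔ s = fun _ => false := by
  classical
  constructor
  · intro h
    funext v
    by_contra hv
    have h1 := capCount_succ_of_isCap (s := s) (h := v) ⟨v.2, by simpa using hv⟩
    have h2 := capCount_mono s (show (v : ℕ) + 1 ≤ n from v.2)
    omega
  · rintro rfl
    simp [capCount, IsCap, Nat.count_eq_card_filter_range]

/-- A resolution `s` of a chain of `n` locks contains the relation `S`. -/
structure ContainsResolution {n : ℕ} (s : Fin n → Bool) (S : Setoid ((Fin n × Corner) ⊕ Corner)) :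
    Prop where
  edge : ∀ x, S x (chainEdge n x)
  resolve : ∀ v c, S (.inl (v, c)) (.inl (v, resolve (s v) c))

namespace ContainsResolution

variable {n : ℕ} {s : Fin n → Bool} {S : Setoid ((Fin n × Corner) ⊕ Corner)}

theorem of_gridPoint_eq (hS : ContainsResolution s S) {x y : (Fin n × Corner) ⊕ Corner}
    (h : gridPoint n x = gridPoint n y) : S x y := by
  rcases eq_or_eq_chainEdge n h with rfl | rfl
  · exact S.refl _
  · exact hS.edge x

theorem rel_gridRep (hS : ContainsResolution s S) {x : (Fin n × Corner) ⊕ Corner} {h : ℕ}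
    {l : Bool} (hx : gridPoint n x = (h, l)) : S x (gridRep n h l) := by
  refine hS.of_gridPoint_eq ?_
  have := gridPoint_fst_le n x
  rw [hx] at this ⊢
  rw [gridPoint_gridRep n h l this]

theorem gridRep_succ (hS : ContainsResolution s S) {h : ℕ} (hh : h < n) (hc : ¬ IsCap s h)
    (l : Bool) : S (gridRep n h l) (gridRep n (h + 1) l) := by
  have h0 : s ⟨h, hh⟩ = false := by simpa [IsCap, hh] using hc
  have h1 := hS.resolve ⟨h, hh⟩ (true, l)
  rw [h0] at h1
  exact S.trans (S.symm (hS.rel_gridRep rfl)) (S.trans h1 (hS.rel_gridRep rfl))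

theorem gridRep_of_isCap (hS : ContainsResolution s S) {h : ℕ} (hc : IsCap s h) :
    S (gridRep n h true) (gridRep n h false) ∧
      S (gridRep n (h + 1) true) (gridRep n (h + 1) false) := by
  obtain ⟨hh, h0⟩ := hc
  have h1 := hS.resolve ⟨h, hh⟩ (true, true)
  have h2 := hS.resolve ⟨h, hh⟩ (false, true)
  rw [h0] at h1 h2
  exact ⟨S.trans (S.symm (hS.rel_gridRep rfl)) (S.trans h1 (hS.rel_gridRep rfl)),
    S.trans (S.symm (hS.rel_gridRep rfl)) (S.trans h2 (hS.rel_gridRep rfl))⟩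

theorem gridRep_of_le (hS : ContainsResolution s S) {h h' : ℕ} (hh : h ≤ h') (hn : h' ≤ n)
    (hc : capCount s h = capCount s h') (l : Bool) : S (gridRep n h l) (gridRep n h' l) := by
  induction h', hh using Nat.le_induction with
  | base => exact S.refl _
  | succ m hm ih =>
    have h1 := capCount_mono s hm
    by_cases hcap : IsCap s m
    · rw [capCount_succ_of_isCap hcap] at hc
      omega
    · rw [capCount_succ_of_not_isCap hcap] at hc
      exact S.trans (ih (by omega) hc) (hS.gridRep_succ (by omega) hcap l)

theorem gridRep_of_capCount_eq (hS : ContainsResolution s S) {h h' : ℕ} (hh : h ≤ n) (hn : h' ≤ n)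
    (hc : capCount s h = capCount s h') (l : Bool) : S (gridRep n h l) (gridRep n h' l) := by
  rcases le_total h h' with hle | hle
  · exact hS.gridRep_of_le hle hn hc l
  · exact S.symm (hS.gridRep_of_le hle hh hc.symm l)

theorem gridRep_sides_zero_iff (hS : ContainsResolution s S) {h : ℕ} (hh : h ≤ n) :
    S (gridRep n 0 true) (gridRep n 0 false) ↔ S (gridRep n h true) (gridRep n h false) := by
  induction h with
  | zero => rfl
  | succ h ih =>
    rw [ih (by omega)]
    by_cases hc : IsCap s h
    · exact iff_of_true (hS.gridRep_of_isCap hc).1 (hS.gridRep_of_isCap hc).2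
    · have h1 := hS.gridRep_succ (by omega) hc true
      have h2 := hS.gridRep_succ (by omega) hc false
      exact ⟨fun h3 => S.trans (S.symm h1) (S.trans h3 h2),
        fun h3 => S.trans h1 (S.trans h3 (S.symm h2))⟩

theorem sides_of_capCount_pos (hS : ContainsResolution s S) (hk : 0 < capCount s n) :
    S (gridRep n 0 true) (gridRep n 0 false) := by
  have h1 : ∃ h, IsCap s h := by
    by_contra hno
    push Not at hno
    have := (capCount_eq_zero_iff s).2 (funext fun v => by
      have := hno v
      simpa [IsCap] using this)
    omega
  obtain ⟨h, hc⟩ := h1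
  exact (hS.gridRep_sides_zero_iff (le_of_lt hc.choose)).2 (hS.gridRep_of_isCap hc).1

/-- If the sides are connected, then curves are determined by the number of caps above. -/
theorem of_capCount_eq (hS : ContainsResolution s S) (h0 : S (gridRep n 0 true) (gridRep n 0 false))
    {x y : (Fin n × Corner) ⊕ Corner}
    (hc : capCount s (gridPoint n x).1 = capCount s (gridPoint n y).1) : S x y := by
  have hx : S x (gridRep n (gridPoint n x).1 (gridPoint n x).2) := hS.rel_gridRep rfl
  have hy : S y (gridRep n (gridPoint n y).1 (gridPoint n y).2) := hS.rel_gridRep rfl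
  have h1 := hS.gridRep_of_capCount_eq (gridPoint_fst_le n x) (gridPoint_fst_le n y) hc
    (gridPoint n x).2
  refine S.trans hx (S.trans (S.trans h1 ?_) (S.symm hy))
  have h2 := (hS.gridRep_sides_zero_iff (gridPoint_fst_le n y)).1 h0
  revert h2
  generalize (gridPoint n x).2 = a
  generalize (gridPoint n y).2 = b
  intro h2
  rcases a with _ | _ <;> rcases b with _ | _
  · exact S.refl _
  · exact S.symm h2
  · exact h2
  · exact S.refl _

theorem of_side_eq (hS : ContainsResolution s S) (hk : capCount s n = 0)
    {x y : (Fin n × Corner) ⊕ Corner} (hc : (gridPoint n x).2 = (gridPoint n y).2) : S x y := by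
  have hx : S x (gridRep n (gridPoint n x).1 (gridPoint n x).2) := hS.rel_gridRep rfl
  have hy : S y (gridRep n (gridPoint n y).1 (gridPoint n y).2) := hS.rel_gridRep rfl
  have h1 := capCount_mono s (gridPoint_fst_le n x)
  have h2 := capCount_mono s (gridPoint_fst_le n y)
  have h3 := hS.gridRep_of_capCount_eq (gridPoint_fst_le n x) (gridPoint_fst_le n y) (by omega)
    (gridPoint n x).2
  rw [← hc] at hy
  exact S.trans hx (S.trans h3 (S.symm hy))

end ContainsResolution

theorem curves_containsResolution (n : ℤ) (s : Fin n.natAbs → Bool) :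
    ContainsResolution s ((chain n).curves s) where
  edge _ := .rel _ _ (.inl rfl)
  resolve v c := .rel _ _ (.inr ⟨v, c, rfl, rfl⟩)

theorem closedCurves_containsResolution (n : ℤ) (s : Fin n.natAbs → Bool) (g : Corner → Corner) :
    ContainsResolution s ((chain n).closedCurves g s) where
  edge _ := .rel _ _ (.inl (.inl rfl))
  resolve v c := .rel _ _ (.inl (.inr ⟨v, c, rfl, rfl⟩))

theorem curves_le_ker {n : ℤ} {s : Fin n.natAbs → Bool} {α : Type*}
    (F : (Fin n.natAbs × Corner) ⊕ Corner → α)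
    (h1 : ∀ x, F (chainEdge _ x) = F x)
    (h2 : ∀ v c, F (.inl (v, resolve (s v) c)) = F (.inl (v, c))) :
    (chain n).curves s ≤ Setoid.ker F := by
  refine Setoid.eqvGen_le ?_
  rintro x y (rfl | ⟨v, c, rfl, rfl⟩)
  · exact (h1 x).symm
  · exact (h2 v c).symm

theorem closedCurves_le_ker {n : ℤ} {s : Fin n.natAbs → Bool} {g : Corner → Corner} {α : Type*}
    (F : (Fin n.natAbs × Corner) ⊕ Corner → α)
    (h1 : ∀ x, F (chainEdge _ x) = F x)
    (h2 : ∀ v c, F (.inl (v, resolve (s v) c)) = F (.inl (v, c)))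
    (h3 : ∀ b, F (.inr (g b)) = F (.inr b)) :
    (chain n).closedCurves g s ≤ Setoid.ker F := by
  refine Setoid.eqvGen_le ?_
  rintro x y ((rfl | ⟨v, c, rfl, rfl⟩) | ⟨b, rfl, rfl⟩)
  · exact (h1 x).symm
  · exact (h2 v c).symm
  · exact (h3 b).symm

theorem side_resolve {n : ℕ} {s : Fin n → Bool} (hk : capCount s n = 0) (v : Fin n) (c : Corner) :
    (gridPoint n (.inl (v, resolve (s v) c))).2 = (gridPoint n (.inl (v, c))).2 := by
  rw [(capCount_eq_zero_iff s).1 hk]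
  rcases c with ⟨_ | _, l⟩ <;> rfl

theorem capCount_resolve {n : ℕ} (s : Fin n → Bool) (v : Fin n) (c : Corner) :
    capCount s (gridPoint n (.inl (v, resolve (s v) c))).1 =
      capCount s (gridPoint n (.inl (v, c))).1 := by
  rcases hv : s v with _ | _ <;> rcases c with ⟨_ | _, l⟩ <;>
    simp only [resolve, gridPoint, Bool.not_false, Bool.not_true]
  · rw [capCount_succ_of_not_isCap (by simp [IsCap, hv])]
  · rw [capCount_succ_of_not_isCap (by simp [IsCap, hv])]

theorem curves_eq_ker_side {n : ℤ} {s : Fin n.natAbs → Bool} (hk : capCount s n.natAbs = 0) :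
    (chain n).curves s = Setoid.ker fun x => (gridPoint n.natAbs x).2 := by
  refine le_antisymm (curves_le_ker _ (fun x => ?_) (side_resolve hk)) fun x y h =>
    (curves_containsResolution n s).of_side_eq hk h
  rw [gridPoint_chainEdge]

theorem curves_eq_ker_capCount {n : ℤ} {s : Fin n.natAbs → Bool} (hk : 0 < capCount s n.natAbs) :
    (chain n).curves s = Setoid.ker fun x => capCount s (gridPoint n.natAbs x).1 := by
  refine le_antisymm (curves_le_ker _ (fun x => ?_) (capCount_resolve s)) fun x y h =>
    (curves_containsResolution n s).of_capCount_eq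
      ((curves_containsResolution n s).sides_of_capCount_pos hk) h
  rw [gridPoint_chainEdge]

theorem closedCurves_joinSides_eq_ker_side {n : ℤ} {s : Fin n.natAbs → Bool}
    (hk : capCount s n.natAbs = 0) :
    (chain n).closedCurves joinSides s = Setoid.ker fun x => (gridPoint n.natAbs x).2 := by
  refine le_antisymm (closedCurves_le_ker _ (fun x => ?_) (side_resolve hk) ?_) fun x y h =>
    (closedCurves_containsResolution n s _).of_side_eq hk h
  · rw [gridPoint_chainEdge]
  · rintro ⟨_ | _, l⟩ <;> rfl

theorem closedCurves_joinHeights_eq_ker {n : ℤ} (s : Fin n.natAbs → Bool) :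
    (chain n).closedCurves joinHeights s =
      Setoid.ker fun x => capCount s (gridPoint n.natAbs x).1 := by
  have hS := closedCurves_containsResolution n s joinHeights
  refine le_antisymm (closedCurves_le_ker _ (fun x => ?_) (capCount_resolve s) ?_) fun x y h =>
    hS.of_capCount_eq ?_ h
  · rw [gridPoint_chainEdge]
  · rintro ⟨_ | _, l⟩ <;> rfl
  · exact .rel _ _ (.inr ⟨(true, true), dif_neg (by omega), dif_neg (by omega)⟩)

theorem closedCurves_joinSides_eq_ker_capCount {n : ℤ} {s : Fin n.natAbs → Bool}
    (hk : 0 < capCount s n.natAbs) :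
    (chain n).closedCurves joinSides s =
      Setoid.ker fun x => if capCount s (gridPoint n.natAbs x).1 = capCount s n.natAbs then 0
        else capCount s (gridPoint n.natAbs x).1 := by
  have hS := closedCurves_containsResolution n s joinSides
  have hsides := hS.sides_of_capCount_pos hk
  refine le_antisymm (closedCurves_le_ker _ (fun x => ?_) (fun v c => ?_) ?_) fun x y h => ?_
  · rw [gridPoint_chainEdge]
  · rw [capCount_resolve]
  · rintro ⟨_ | _, l⟩ <;> simp [gridPoint, joinSides, capCount_zero]
  · have hend : (chain n).closedCurves joinSides s (.inr (true, true)) (.inr (false, true)) :=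
      .rel _ _ (.inr ⟨(true, true), rfl, rfl⟩)
    have hbot : ∀ z, capCount s (gridPoint n.natAbs z).1 = capCount s n.natAbs →
        (chain n).closedCurves joinSides s z (.inr (true, true)) := fun z hz =>
      Setoid.trans' _ (hS.of_capCount_eq (y := .inr (false, true)) hsides hz) (Setoid.symm' _ hend)
    have htop : ∀ z, capCount s (gridPoint n.natAbs z).1 = 0 →
        (chain n).closedCurves joinSides s z (.inr (true, true)) := fun z hz =>
      hS.of_capCount_eq hsides (hz.trans (capCount_zero s).symm)
    replace h := Setoid.ker_def.1 h
    split_ifs at h with hx hy hy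
    · exact Setoid.trans' _ (hbot x hx) (Setoid.symm' _ (hbot y hy))
    · exact Setoid.trans' _ (hbot x hx) (Setoid.symm' _ (htop y h.symm))
    · exact Setoid.trans' _ (htop x h) (Setoid.symm' _ (hbot y hy))
    · exact hS.of_capCount_eq hsides h

theorem range_capCount {n : ℕ} (s : Fin n → Bool) :
    Set.range (fun x => capCount s (gridPoint n x).1) = Set.Iic (capCount s n) := by
  ext k
  constructor
  · rintro ⟨x, rfl⟩
    exact capCount_mono s (gridPoint_fst_le n x)
  · intro hk
    obtain ⟨h, hh, rfl⟩ := exists_capCount_eq s hk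
    exact ⟨gridRep n h true, by simp only [gridPoint_gridRep n h true hh]⟩

theorem natCard_quotient_ker {α β : Type*} (F : α → β) :
    Nat.card (Quotient (Setoid.ker F)) = (Set.range F).ncard :=
  Nat.card_congr (Setoid.quotientKerEquivRange F)

theorem range_side (n : ℕ) : Set.range (fun x => (gridPoint n x).2) = Set.univ := by
  exact Set.eq_univ_of_forall fun l => ⟨Sum.inr (true, l), rfl⟩

theorem card_joinSides_of_eq_zero {n : ℤ} {s : Fin n.natAbs → Bool}
    (hk : capCount s n.natAbs = 0) :
    Nat.card (Quotient ((chain n).closedCurves joinSides s)) = 2 := by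
  rw [closedCurves_joinSides_eq_ker_side hk]
  refine ((natCard_quotient_ker _).trans (congrArg Set.ncard (range_side n.natAbs))).trans ?_
  simp

theorem card_joinSides_of_pos {n : ℤ} {s : Fin n.natAbs → Bool}
    (hk : 0 < capCount s n.natAbs) :
    Nat.card (Quotient ((chain n).closedCurves joinSides s)) = capCount s n.natAbs := by
  rw [closedCurves_joinSides_eq_ker_capCount hk]
  have : Set.range (fun x : (Fin n.natAbs × Corner) ⊕ Corner =>
      if capCount s (gridPoint n.natAbs x).1 = capCount s n.natAbs then 0
        else capCount s (gridPoint n.natAbs x).1) = Set.Iio (capCount s n.natAbs) := by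
    ext k
    constructor
    · rintro ⟨x, rfl⟩
      have := capCount_mono s (gridPoint_fst_le _ x)
      simp only [Set.mem_Iio]
      split_ifs with h <;> omega
    · intro hk'
      have h1 : k ∈ Set.Iic (capCount s n.natAbs) := Set.mem_Iic.2 (Set.mem_Iio.1 hk').le
      rw [← range_capCount] at h1
      obtain ⟨x, rfl⟩ := h1
      exact ⟨x, if_neg (ne_of_lt hk')⟩
  refine ((natCard_quotient_ker _).trans (congrArg Set.ncard this)).trans ?_
  simp [Set.ncard_eq_toFinset_card']

theorem card_joinHeights {n : ℤ} (s : Fin n.natAbs → Bool) :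
    Nat.card (Quotient ((chain n).closedCurves joinHeights s)) = capCount s n.natAbs + 1 := by
  rw [closedCurves_joinHeights_eq_ker]
  refine ((natCard_quotient_ker _).trans (congrArg Set.ncard (range_capCount s))).trans ?_
  simp [Set.ncard_eq_toFinset_card']

theorem natCard_quotient_ker_ne {α β γ : Type*} (F : α → β) (i : γ → α) :
    Nat.card {k : Quotient (Setoid.ker F) // ∀ b, k ≠ Quotient.mk _ (i b)} =
      (Set.range F \ Set.range (F ∘ i)).ncard := by
  refine Nat.card_congr (Equiv.ofBijective (fun k => ⟨Setoid.quotientKerEquivRange F k.1, ?_, ?_⟩)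
    ⟨fun a b h => ?_, ?_⟩)
  · exact Subtype.property _
  · rintro ⟨b, hb⟩
    refine k.2 b ((Setoid.quotientKerEquivRange F).injective (Subtype.ext ?_))
    exact hb.symm
  · exact Subtype.ext ((Setoid.quotientKerEquivRange F).injective
      (Subtype.ext (Subtype.mk.inj h)))
  · rintro ⟨_, ⟨x, rfl⟩, hx⟩
    refine ⟨⟨Quotient.mk _ x, fun b hb => hx ⟨b, ?_⟩⟩, Subtype.ext rfl⟩
    exact (Quotient.exact hb).symm

theorem cycles_of_eq_zero {n : ℤ} {s : Fin n.natAbs → Bool} (hk : capCount s n.natAbs = 0) :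
    (chain n).cycles s = 0 := by
  unfold cycles
  rw [curves_eq_ker_side hk]
  refine (natCard_quotient_ker_ne _ _).trans ?_
  rw [Set.ncard_eq_zero, Set.sdiff_eq_empty]
  rintro l -
  exact ⟨(true, l), rfl⟩

theorem cycles_of_pos {n : ℤ} {s : Fin n.natAbs → Bool} (hk : 0 < capCount s n.natAbs) :
    (chain n).cycles s = capCount s n.natAbs - 1 := by
  unfold cycles
  rw [curves_eq_ker_capCount hk]
  have h1 : Set.range ((fun x : (Fin n.natAbs × Corner) ⊕ Corner =>
      capCount s (gridPoint n.natAbs x).1) ∘ Sum.inr) = {0, capCount s n.natAbs} := by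
    ext k
    constructor
    · rintro ⟨⟨_ | _, l⟩, rfl⟩ <;> simp [gridPoint, capCount_zero]
    · rintro (rfl | rfl)
      · exact ⟨(true, true), capCount_zero s⟩
      · exact ⟨(false, true), rfl⟩
  have h2 : Set.Iic (capCount s n.natAbs) \ {0, capCount s n.natAbs} =
      Set.Ioo 0 (capCount s n.natAbs) := by
    ext k
    simp only [Set.mem_sdiff, Set.mem_Iic, Set.mem_insert_iff, Set.mem_singleton_iff, Set.mem_Ioo]
    omega
  refine (natCard_quotient_ker_ne _ _).trans ((congrArg Set.ncard
    ((congrArg₂ (· \ ·) (range_capCount s) h1).trans h2)).trans ?_)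
  simp [Set.ncard_eq_toFinset_card']

theorem connection_of_eq_zero {n : ℤ} {s : Fin n.natAbs → Bool} (hk : capCount s n.natAbs = 0) :
    (chain n).connection s = vertical := by
  unfold connection
  rw [curves_eq_ker_side hk]
  ext ⟨_ | _, l⟩ ⟨_ | _, l'⟩ <;> rfl

theorem connection_of_pos {n : ℤ} {s : Fin n.natAbs → Bool} (hk : 0 < capCount s n.natAbs) :
    (chain n).connection s = horizontal := by
  unfold connection
  rw [curves_eq_ker_capCount hk]
  ext ⟨a, l⟩ ⟨b, l'⟩
  change capCount s _ = capCount s _ ↔ a = b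
  rcases a with _ | _ <;> rcases b with _ | _ <;>
    simp [gridPoint, capCount_zero, hk.ne, hk.ne']

section Field

variable {𝕂 : Type*} [Field 𝕂]

theorem sum_pow_capCount (n : ℕ) (x : 𝕂) :
    ∑ s : Fin n → Bool, x ^ capCount s n = (1 + x) ^ n := by
  simp_rw [← prod_ite_eq_pow_capCount]
  rw [← Fintype.prod_sum (fun _ (b : Bool) => if b then x else 1)]
  simp [add_comm]

theorem coeff_chain (n : ℤ) (f f' : 𝕂) (s : Fin n.natAbs → Bool) :
    (chain n).coeff f f' s = (if 0 ≤ n then f else f') ^ capCount s n.natAbs := by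
  rw [← prod_ite_eq_pow_capCount]
  simp only [coeff, chain, decide_eq_true_eq]
  rfl

/-- A sum over resolutions, with the one without caps split off. -/
theorem sum_resolutions {M : Type*} [AddCommMonoid M] (n : ℕ) (F : (Fin n → Bool) → M) :
    ∑ s, F s = F (fun _ => false) + ∑ s with 0 < capCount s n, F s := by
  rw [← Finset.sum_filter_add_sum_filter_not Finset.univ (fun s => 0 < capCount s n), add_comm]
  congr 1
  have : (Finset.univ.filter fun s : Fin n → Bool => ¬ 0 < capCount s n) = {fun _ => false} := by
    ext s
    simp [capCount_eq_zero_iff, Nat.pos_iff_ne_zero]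
  rw [this, Finset.sum_singleton]

theorem sum_pow_capCount_pos (n : ℕ) (x : 𝕂) :
    ∑ s : Fin n → Bool with 0 < capCount s n, x ^ capCount s n = (1 + x) ^ n - 1 := by
  rw [← sum_pow_capCount, sum_resolutions n fun s => x ^ capCount s n,
    (capCount_eq_zero_iff _).2 rfl]
  ring

theorem capCount_false (n : ℕ) : capCount (fun _ : Fin n => false) n = 0 :=
  (capCount_eq_zero_iff _).2 rfl

theorem closedPolynomial_joinSides (n : ℤ) (f f' δ : 𝕂) :
    (chain n).closedPolynomial joinSides f f' δ =
      δ ^ 2 + ((1 + (if 0 ≤ n then f else f') * δ) ^ n.natAbs - 1) := by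
  refine (sum_resolutions n.natAbs _).trans ?_
  rw [← sum_pow_capCount_pos, card_joinSides_of_eq_zero (capCount_false _), coeff_chain,
    capCount_false, pow_zero, mul_one]
  congr 1
  refine Finset.sum_congr rfl fun s hs => ?_
  rw [card_joinSides_of_pos (Finset.mem_filter.1 hs).2, coeff_chain, mul_pow, mul_comm]

theorem closedPolynomial_joinHeights (n : ℤ) (f f' δ : 𝕂) :
    (chain n).closedPolynomial joinHeights f f' δ =
      δ * (1 + (if 0 ≤ n then f else f') * δ) ^ n.natAbs := by
  rw [← sum_pow_capCount, Finset.mul_sum]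
  refine Finset.sum_congr rfl fun (s : Fin n.natAbs → Bool) _ => ?_
  rw [card_joinHeights, coeff_chain]
  ring

theorem planar_chain (n : ℤ) (f f' : 𝕂) {δ : 𝕂} (hδ : δ ≠ 0) :
    (chain n).planar f f' δ = Finsupp.single vertical 1 +
      Finsupp.single horizontal (((1 + (if 0 ≤ n then f else f') * δ) ^ n.natAbs - 1) / δ) := by
  refine (sum_resolutions n.natAbs _).trans ?_
  rw [connection_of_eq_zero (capCount_false _), cycles_of_eq_zero (capCount_false _), coeff_chain,
    capCount_false, ← sum_pow_capCount_pos, Finset.sum_div, pow_zero, pow_zero, mul_one]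
  congr 1
  refine Eq.trans ?_ (map_sum (Finsupp.singleAddHom horizontal) _ _).symm
  refine Finset.sum_congr rfl fun s hs => ?_
  have hs := (Finset.mem_filter.1 hs).2
  rw [connection_of_pos hs, cycles_of_pos hs, coeff_chain, Finsupp.singleAddHom_apply]
  congr 1
  obtain ⟨k, hk⟩ := Nat.exists_eq_succ_of_ne_zero hs.ne'
  rw [hk, eq_div_iff hδ, mul_pow, Nat.succ_sub_one, pow_succ δ]
  ring

end Field

end LockTangle
end AntiparallelChain

namespace AntiparallelChain

namespace State

variable {N : ℕ} {a b : Ob}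

/-- The basis label of a tensor product given by two labels. -/
def pair (x : State N a) (y : State N b) : State N (.tensor a b) := (x, y)

/-- The basis label of the empty word. -/
def star : State N .unit := ()

/-- The basis labels of an upward strand. -/
def ofUp (i : Fin N) : State N .up := i

/-- The basis labels of a downward strand. -/
def ofDown (i : Fin N) : State N .down := i

theorem pair_inj {x x' : State N a} {y y' : State N b} :
    pair x y = pair x' y' ↔ x = x' ∧ y = y' := Prod.mk_inj

theorem ofUp_inj {i j : Fin N} : ofUp i = ofUp j ↔ i = j := Iff.rfl

theorem ofDown_inj {i j : Fin N} : ofDown i = ofDown j ↔ i = j := Iff.rfl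

theorem sum_tensor {M : Type*} [AddCommMonoid M] (f : State N (.tensor a b) → M) :
    ∑ x, f x = ∑ x : State N a, ∑ y : State N b, f (pair x y) :=
  Fintype.sum_prod_type (γ := M) (α₁ := State N a) (α₂ := State N b) f

theorem sum_up {M : Type*} [AddCommMonoid M] (f : State N .up → M) :
    ∑ x, f x = ∑ i : Fin N, f (ofUp i) := rfl

theorem sum_down {M : Type*} [AddCommMonoid M] (f : State N .down → M) :
    ∑ x, f x = ∑ i : Fin N, f (ofDown i) := rfl

theorem sum_unit {M : Type*} [AddCommMonoid M] (f : State N .unit → M) :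
    ∑ x, f x = f star := Fintype.sum_unique (ι := Unit) f

end State

open State

section Operators

variable {K : Type*} [Field K] {q : K} {N : ℕ}

theorem mul_ofMap_apply {S T U : Type} [Fintype T] [DecidableEq T] (M : Matrix U T K) (e : S → T)
    (y : U) (x : S) : (M * (ofMap e : Matrix T S K)) y x = M y (e x) := by
  simp [Matrix.mul_apply, ofMap]

theorem ofMap_mul_apply {S T U : Type} [Fintype S] [DecidableEq T] {e : S → T} (e' : T → S)
    (h : ∀ x y, y = e x ↔ x = e' y) (M : Matrix S U K) (y : T) (x : U) :
    ((ofMap e : Matrix T S K) * M) y x = M (e' y) x := by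
  classical
  simp [Matrix.mul_apply, ofMap, h]

theorem rt_assoc_comp_apply {a b c d : Ob} (f : Diag (.tensor a (.tensor b c)) d)
    (y : State N d) (x₁ : State N a) (x₂ : State N b) (x₃ : State N c) :
    rt q N ((Diag.assoc a b c).comp f) y (pair (pair x₁ x₂) x₃) =
      rt q N f y (pair x₁ (pair x₂ x₃)) :=
  mul_ofMap_apply _ _ _ _

theorem rt_comp_assocInv_apply {a b c d : Ob} (f : Diag d (.tensor a (.tensor b c)))
    (x : State N d) (y₁ : State N a) (y₂ : State N b) (y₃ : State N c) :
    rt q N (f.comp (Diag.assocInv a b c)) (pair (pair y₁ y₂) y₃) x =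
      rt q N f (pair y₁ (pair y₂ y₃)) x :=
  ofMap_mul_apply
    (fun y : (State N a × State N b) × State N c => (pair y.1.1 (pair y.1.2 y.2)))
    (fun _ _ => ⟨fun h => by subst h; rfl, fun h => by subst h; rfl⟩) _ _ _

theorem rt_comp_lunit_apply {a d : Ob} (f : Diag d (.tensor .unit a)) (x : State N d)
    (y : State N a) : rt q N (f.comp (Diag.lunit a)) y x = rt q N f (pair star y) x :=
  ofMap_mul_apply (fun y : State N a => pair star y)
    (fun _ _ => ⟨fun h => by subst h; rfl, fun h => by subst h; rfl⟩) _ _ _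

theorem rt_comp_runit_apply {a d : Ob} (f : Diag d (.tensor a .unit)) (x : State N d)
    (y : State N a) : rt q N (f.comp (Diag.runit a)) y x = rt q N f (pair y star) x :=
  ofMap_mul_apply (fun y : State N a => pair y star)
    (fun _ _ => ⟨fun h => by subst h; rfl, fun h => by subst h; rfl⟩) _ _ _

theorem rt_lunitInv_comp_apply {a d : Ob} (f : Diag (.tensor .unit a) d) (y : State N d)
    (x : State N a) : rt q N ((Diag.lunitInv a).comp f) y x = rt q N f y (pair star x) :=
  mul_ofMap_apply _ _ _ _

theorem rt_runitInv_comp_apply {a d : Ob} (f : Diag (.tensor a .unit) d) (y : State N d)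
    (x : State N a) : rt q N ((Diag.runitInv a).comp f) y x = rt q N f y (pair x star) :=
  mul_ofMap_apply _ _ _ _

theorem rt_comp_apply {a b c : Ob} (f : Diag a b) (g : Diag b c) (y : State N c) (x : State N a) :
    rt q N (f.comp g) y x = ∑ z, rt q N g y z * rt q N f z x := rfl

theorem rt_tensor_apply {a b c d : Ob} (f : Diag a b) (g : Diag c d) (y₁ : State N b)
    (y₂ : State N d) (x₁ : State N a) (x₂ : State N c) :
    rt q N (f.tensor g) (pair y₁ y₂) (pair x₁ x₂) = rt q N f y₁ x₁ * rt q N g y₂ x₂ := rfl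

theorem rt_id_apply (a : Ob) (y x : State N a) :
    rt q N (Diag.id a) y x = if y = x then 1 else 0 := Matrix.one_apply

theorem rt_id_tensor_comp_apply {a b c e : Ob} (f : Diag b c) (g : Diag (.tensor a c) e)
    (y : State N e) (x₁ : State N a) (x₂ : State N b) :
    rt q N (((Diag.id a).tensor f).comp g) y (pair x₁ x₂) =
      ∑ z, rt q N g y (pair x₁ z) * rt q N f z x₂ := by
  rw [rt_comp_apply, sum_tensor, Finset.sum_eq_single x₁]
  · simp [rt_tensor_apply, rt_id_apply]
  · intro z _ hz
    simp [rt_tensor_apply, rt_id_apply, hz]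
  · simp

theorem rt_tensor_id_comp_apply {a b c e : Ob} (f : Diag b c) (g : Diag (.tensor c a) e)
    (y : State N e) (x₁ : State N b) (x₂ : State N a) :
    rt q N ((f.tensor (Diag.id a)).comp g) y (pair x₁ x₂) =
      ∑ z, rt q N g y (pair z x₂) * rt q N f z x₁ := by
  rw [rt_comp_apply, sum_tensor]
  refine Finset.sum_congr rfl fun z _ => ?_
  rw [Finset.sum_eq_single x₂]
  · simp [rt_tensor_apply, rt_id_apply]
  · intro w _ hw
    simp [rt_tensor_apply, rt_id_apply, hw]
  · simp

theorem rt_assoc_apply {a b c : Ob} (y : State N (.tensor a (.tensor b c))) (x₁ : State N a)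
    (x₂ : State N b) (x₃ : State N c) :
    rt q N (Diag.assoc a b c) y (pair (pair x₁ x₂) x₃) =
      if y = pair x₁ (pair x₂ x₃) then 1 else 0 := rfl

theorem rt_assocInv_apply {a b c : Ob} (y : State N (.tensor (.tensor a b) c)) (x₁ : State N a)
    (x₂ : State N b) (x₃ : State N c) :
    rt q N (Diag.assocInv a b c) y (pair x₁ (pair x₂ x₃)) =
      if y = pair (pair x₁ x₂) x₃ then 1 else 0 := rfl

theorem rt_middle_apply (a d : Ob) {b c b' c' : Ob} (f : Diag (.tensor b c) (.tensor b' c'))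
    (a₁ a₀ : State N a) (d₁ d₀ : State N d) (b₁ : State N b') (c₁ : State N c') (b₀ : State N b)
    (c₀ : State N c) :
    rt q N (middle a d f) (pair (pair a₁ b₁) (pair c₁ d₁)) (pair (pair a₀ b₀) (pair c₀ d₀)) =
      if a₁ = a₀ ∧ d₁ = d₀ then rt q N f (pair b₁ c₁) (pair b₀ c₀) else 0 := by
  rw [middle, rt_assoc_comp_apply, rt_id_tensor_comp_apply]
  simp only [rt_assocInv_apply, mul_ite, mul_one, mul_zero, Finset.sum_ite_eq',
    Finset.mem_univ, if_true]
  rw [rt_id_tensor_comp_apply]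
  simp only [sum_tensor, rt_tensor_apply, rt_id_apply, rt_assoc_apply,
    rt_comp_assocInv_apply, pair_inj, ite_and, mul_ite, ite_mul, mul_one, mul_zero, one_mul,
    zero_mul, Finset.sum_ite_eq, Finset.sum_ite_eq', Finset.sum_ite_irrel, Finset.sum_const_zero,
    Finset.mem_univ, if_true]

/-- The matrix of a crossing of two upward strands. -/
def crossMatrix (q : K) (N : ℕ) (positive : Bool) : Matrix (Fin N × Fin N) (Fin N × Fin N) K :=
  if positive then rMatrix q N else rMatrixInv q N

theorem rt_cross_apply (p : Bool) (i j k l : Fin N) :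
    rt q N (Diag.cross p) (pair (ofUp k) (ofUp l)) (pair (ofUp i) (ofUp j)) =
      crossMatrix q N p (k, l) (i, j) := by
  cases p <;> rfl

theorem rt_cupUD_apply (i j : Fin N) (x : State N .unit) :
    rt q N Diag.cupUD (pair (ofUp i) (ofDown j)) x = if i = j then 1 else 0 := rfl

theorem rt_cupDU_apply (i j : Fin N) (x : State N .unit) :
    rt q N Diag.cupDU (pair (ofDown i) (ofUp j)) x = if i = j then (weight q N i)⁻¹ else 0 := rfl

theorem rt_capUD_apply (i j : Fin N) (x : State N .unit) :
    rt q N Diag.capUD x (pair (ofUp i) (ofDown j)) = if i = j then weight q N i else 0 := rfl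

theorem rt_capDU_apply (i j : Fin N) (x : State N .unit) :
    rt q N Diag.capDU x (pair (ofDown i) (ofUp j)) = if i = j then 1 else 0 := rfl

theorem rt_crossDU_apply (p : Bool) (i j k l : Fin N) :
    rt q N (crossDU p) (pair (ofUp k) (ofDown l)) (pair (ofDown i) (ofUp j)) =
      crossMatrix q N p (i, k) (j, l) := by
  rw [crossDU, rt_runitInv_comp_apply, rt_id_tensor_comp_apply]
  simp only [sum_tensor, sum_up, sum_down, rt_cupUD_apply, mul_ite, mul_one, mul_zero,
    Finset.sum_ite_eq, Finset.mem_univ, if_true]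
  simp only [rt_comp_apply (middle _ _ _), sum_tensor, sum_up, rt_comp_lunit_apply,
    rt_tensor_apply, rt_id_apply, rt_capDU_apply, ofDown_inj, rt_middle_apply,
    rt_cross_apply, ite_and, mul_ite, ite_mul, mul_one, mul_zero, one_mul,
    zero_mul, Finset.sum_ite_eq, Finset.sum_ite_eq', Finset.sum_ite_irrel, Finset.sum_const_zero,
    Finset.mem_univ, if_true]

theorem rt_crossUD_apply (p : Bool) (i j k l : Fin N) :
    rt q N (crossUD p) (pair (ofDown i) (ofUp j)) (pair (ofUp k) (ofDown l)) =
      (weight q N i)⁻¹ * weight q N l * crossMatrix q N p (j, l) (i, k) := by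
  rw [crossUD, rt_lunitInv_comp_apply, rt_tensor_id_comp_apply]
  simp only [sum_tensor, sum_up, sum_down, rt_cupDU_apply, mul_ite, mul_zero,
    Finset.sum_ite_eq, Finset.mem_univ, if_true]
  simp only [rt_comp_apply (middle _ _ _), sum_tensor, sum_up, sum_down, rt_comp_runit_apply,
    rt_tensor_apply, rt_id_apply, rt_capUD_apply, ofDown_inj, rt_middle_apply,
    rt_cross_apply, ite_and, mul_ite, ite_mul, mul_zero, one_mul,
    zero_mul, Finset.sum_ite_eq, Finset.sum_ite_eq', Finset.sum_ite_irrel, Finset.sum_const_zero,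
    Finset.mem_univ, if_true]
  ring

theorem rt_cupCap_apply (i j k l : Fin N) :
    rt q N cupCap (pair (ofDown i) (ofUp j)) (pair (ofDown k) (ofUp l)) =
      if i = j ∧ k = l then (weight q N i)⁻¹ else 0 := by
  rw [cupCap, rt_comp_apply, sum_unit, rt_cupDU_apply, rt_capDU_apply]
  split_ifs <;> simp_all

end Operators
end AntiparallelChain

namespace AntiparallelChain
open State

section LockOperator

variable {K : Type*} [Field K] {q : K} {N : ℕ}

theorem sum_range_ite_lt_sub (F : ℕ → K) (i M : ℕ) :
    ∑ l ∈ Finset.range M, (if l < i then F (l + 1) - F l else 0) = F (min i M) - F 0 := by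
  induction M with
  | zero => simp
  | succ M ih =>
    rw [Finset.sum_range_succ, ih]
    split_ifs with h
    · rw [min_eq_right h.le, min_eq_right (show M + 1 ≤ i from h)]; ring
    · rw [min_eq_left (by omega), min_eq_left (by omega)]; ring

theorem sub_inv_mul_weight (hq : q ≠ 0) (l : Fin N) :
    (q - q⁻¹) * weight q N l = q ^ (2 * ((l + 1 : ℕ) : ℤ) - N) - q ^ (2 * ((l : ℕ) : ℤ) - N) := by
  have h1 : (2 * ((l + 1 : ℕ) : ℤ) - N) = (2 * (l : ℤ) + 1 - N) + 1 := by push_cast; ring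
  have h2 : (2 * ((l : ℕ) : ℤ) - N) = (2 * (l : ℤ) + 1 - N) - 1 := by ring
  rw [h1, h2, zpow_add_one₀ hq, zpow_sub_one₀ hq, weight]
  ring

theorem weight_ne_zero (hq : q ≠ 0) (l : Fin N) : weight q N l ≠ 0 := zpow_ne_zero _ hq

/-- The sum of the weights up to `i`. -/
theorem sum_weight_lt (hq : q ≠ 0) {i : ℕ} (hi : i ≤ N) :
    (q - q⁻¹) * ∑ l : Fin N, (if (l : ℕ) < i then weight q N l else 0) =
      q ^ (2 * (i : ℤ) - N) - q ^ (-(N : ℤ)) := by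
  rw [Finset.mul_sum]
  simp_rw [mul_ite, mul_zero, sub_inv_mul_weight hq]
  rw [Fin.sum_univ_eq_sum_range
    (fun l => if l < i then q ^ (2 * ((l + 1 : ℕ) : ℤ) - N) - q ^ (2 * (l : ℤ) - N) else 0) N,
    sum_range_ite_lt_sub (fun l => q ^ (2 * (l : ℤ) - N)), min_eq_left hi]
  simp

theorem sum_weight (hq : q ≠ 0) :
    (q - q⁻¹) * ∑ l : Fin N, weight q N l = q ^ (N : ℤ) - q ^ (-(N : ℤ)) := by
  have h := sum_weight_lt hq le_rfl (N := N)
  simp only [Fin.is_lt, if_true] at h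
  rw [h]
  ring_nf

theorem sum_weight_head (hq : q ≠ 0) (i : Fin N) :
    (q - q⁻¹) * ∑ l : Fin N, (if l < i then weight q N l else 0) =
      q⁻¹ * weight q N i - q ^ (-(N : ℤ)) := by
  have h := sum_weight_lt hq i.2.le
  simp only [Fin.lt_def]
  rw [h, weight, show 2 * (i : ℤ) - N = (2 * (i : ℤ) + 1 - N) - 1 by ring, zpow_sub_one₀ hq,
    mul_comm q⁻¹]

theorem sum_weight_tail (hq : q ≠ 0) (i : Fin N) :
    (q - q⁻¹) * ∑ l : Fin N, (if i < l then weight q N l else 0) =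
      q ^ (N : ℤ) - q * weight q N i := by
  have h : ∀ l : Fin N, (if i < l then weight q N l else 0) =
      weight q N l - (if (l : ℕ) < (i : ℕ) + 1 then weight q N l else 0) := by
    intro l
    rcases lt_or_ge i l with h | h
    · rw [if_pos h, if_neg (by rw [Fin.lt_def] at h; omega), sub_zero]
    · rw [if_neg h.not_gt, if_pos (by have := Fin.le_def.1 h; omega), sub_self]
  simp_rw [h]
  rw [Finset.sum_sub_distrib, mul_sub, sum_weight hq, sum_weight_lt hq i.2, weight,
    show 2 * ((i + 1 : ℕ) : ℤ) - N = (2 * (i : ℤ) + 1 - N) + 1 by push_cast; ring,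
    zpow_add_one₀ hq]
  ring

theorem sum_weight_inv : ∑ l : Fin N, (weight q N l)⁻¹ = ∑ l : Fin N, weight q N l := by
  refine Fintype.sum_equiv Fin.revPerm _ _ fun l => ?_
  rw [weight, weight, ← zpow_neg, Fin.revPerm_apply, Fin.val_rev]
  congr 1
  have := l.2
  push_cast [Nat.cast_sub (show (l : ℕ) + 1 ≤ N by omega)]
  ring

/-- The nonzero entries of a rotated crossing on the diagonal vectors. -/
def crossDiag (q : K) (N : ℕ) (p : Bool) (i l : Fin N) : K :=
  if p then (if i = l then q else if i < l then q - q⁻¹ else 0)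
  else (if i = l then q⁻¹ else if l < i then -(q - q⁻¹) else 0)

theorem crossMatrix_diag (p : Bool) (i k l : Fin N) :
    crossMatrix q N p (i, k) (i, l) = if k = l then crossDiag q N p i l else 0 := by
  cases p <;> simp only [crossMatrix, rMatrix, rMatrixInv, crossDiag, Matrix.of_apply,
    Prod.mk.injEq, if_true] <;> by_cases h1 : i = l <;> by_cases h2 : k = l <;>
    simp [h1, h2] <;> grind

theorem crossMatrix_offDiag (p : Bool) {i j : Fin N} (h : i ≠ j) (k l : Fin N) :
    crossMatrix q N p (i, k) (j, l) = if k = j ∧ l = i then 1 else 0 := by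
  cases p <;> simp only [crossMatrix, rMatrix, rMatrixInv] <;>
    by_cases h1 : j = l <;> simp [h1] <;> grind

/-- The coefficient of cup-cap in the decomposition of a lock at `A = q ^ N`. -/
def lockCoeff (q : K) (N : ℕ) (p : Bool) : K :=
  if p then q ^ (N : ℤ) * (q - q⁻¹) else -q ^ (-(N : ℤ)) * (q - q⁻¹)

theorem sum_crossDiag_self (hq : q ≠ 0) (p : Bool) (i : Fin N) :
    ∑ l, weight q N l * (crossDiag q N p i l * crossDiag q N p i l) =
      weight q N i + lockCoeff q N p := by
  cases p
  · have h : ∀ l, weight q N l * (crossDiag q N false i l * crossDiag q N false i l) =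
        (if i = l then q⁻¹ ^ 2 * weight q N i else 0) +
          (q - q⁻¹) * ((q - q⁻¹) * (if l < i then weight q N l else 0)) := by
      intro l
      simp only [crossDiag]
      split_ifs with h1 h2 <;> simp_all <;> ring
    simp_rw [h]
    rw [Finset.sum_add_distrib, ← Finset.mul_sum, ← Finset.mul_sum, sum_weight_head hq]
    simp [lockCoeff]
    field_simp
    ring
  · have h : ∀ l, weight q N l * (crossDiag q N true i l * crossDiag q N true i l) =
        (if i = l then q ^ 2 * weight q N i else 0) +
          (q - q⁻¹) * ((q - q⁻¹) * (if i < l then weight q N l else 0)) := by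
      intro l
      simp only [crossDiag]
      split_ifs with h1 h2 <;> simp_all <;> ring
    simp_rw [h]
    rw [Finset.sum_add_distrib, ← Finset.mul_sum, ← Finset.mul_sum, sum_weight_tail hq]
    simp [lockCoeff]
    field_simp
    ring

theorem sum_crossDiag_of_lt (hq : q ≠ 0) (p : Bool) {i j : Fin N} (hij : i < j) :
    ∑ l, weight q N l * (crossDiag q N p i l * crossDiag q N p j l) = lockCoeff q N p := by
  cases p
  · have h : ∀ l, weight q N l * (crossDiag q N false i l * crossDiag q N false j l) =
        -(q - q⁻¹) * (if i = l then q⁻¹ * weight q N i else 0) +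
          (q - q⁻¹) * ((q - q⁻¹) * (if l < i then weight q N l else 0)) := by
      intro l
      simp only [crossDiag]
      rcases lt_trichotomy l i with h | rfl | h
      · simp [h, h.ne', (h.trans hij), (h.trans hij).ne']; ring
      · simp [hij, hij.ne']; ring
      · simp [h.ne, h.not_gt]
    simp_rw [h]
    rw [Finset.sum_add_distrib, ← Finset.mul_sum, ← Finset.mul_sum, ← Finset.mul_sum,
      sum_weight_head hq]
    simp [lockCoeff]
    ring
  · have h : ∀ l, weight q N l * (crossDiag q N true i l * crossDiag q N true j l) =
        (q - q⁻¹) * (if j = l then q * weight q N j else 0) +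
          (q - q⁻¹) * ((q - q⁻¹) * (if j < l then weight q N l else 0)) := by
      intro l
      simp only [crossDiag]
      rcases lt_trichotomy l j with h | rfl | h
      · simp [h.ne', h.not_gt]
      · simp [hij, hij.ne]; ring
      · simp [h, h.ne, (hij.trans h), (hij.trans h).ne]; ring
    simp_rw [h]
    rw [Finset.sum_add_distrib, ← Finset.mul_sum, ← Finset.mul_sum, ← Finset.mul_sum,
      sum_weight_tail hq]
    simp [lockCoeff]
    ring

theorem sum_crossDiag (hq : q ≠ 0) (p : Bool) (i j : Fin N) :
    ∑ l, weight q N l * (crossDiag q N p i l * crossDiag q N p j l) =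
      (if i = j then weight q N i else 0) + lockCoeff q N p := by
  rcases lt_trichotomy i j with h | rfl | h
  · rw [sum_crossDiag_of_lt hq p h, if_neg h.ne, zero_add]
  · rw [sum_crossDiag_self hq, if_pos rfl]
  · rw [if_neg h.ne', zero_add, ← sum_crossDiag_of_lt hq p h]
    exact Finset.sum_congr rfl fun l _ => by ring

theorem rt_lock_apply (hq : q ≠ 0) (p : Bool) (i j i₀ j₀ : Fin N) :
    rt q N (lock p) (pair (ofDown i) (ofUp j)) (pair (ofDown i₀) (ofUp j₀)) =
      (if i = i₀ ∧ j = j₀ then 1 else 0) +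
        lockCoeff q N p * (if i = j ∧ i₀ = j₀ then (weight q N i)⁻¹ else 0) := by
  rw [lock, rt_comp_apply, sum_tensor]
  simp only [sum_up, sum_down, rt_crossDU_apply, rt_crossUD_apply]
  have hw := weight_ne_zero hq i
  by_cases h0 : i₀ = j₀
  · subst h0
    simp only [crossMatrix_diag, mul_ite, mul_zero, Finset.sum_ite_eq, Finset.mem_univ, if_true]
    by_cases h : i = j
    · subst h
      have := sum_crossDiag hq p i i₀
      simp only [crossMatrix_diag, if_true, and_self]
      simp_rw [mul_assoc]
      rw [← Finset.mul_sum, this]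
      split_ifs <;> field_simp <;> ring
    · rw [if_neg (by rintro ⟨rfl, rfl⟩; exact h rfl), if_neg (by tauto), add_zero]
      refine Finset.sum_eq_zero fun l _ => ?_
      rw [crossMatrix_offDiag p (Ne.symm h), if_neg (by rintro ⟨rfl, rfl⟩; exact h rfl)]
      ring
  · simp only [crossMatrix_offDiag p h0, ite_and, mul_ite, mul_one, mul_zero, Finset.sum_ite_irrel,
      Finset.sum_const_zero, Finset.sum_ite_eq', Finset.mem_univ, if_true]
    by_cases h : i = j
    · subst h
      rw [crossMatrix_diag, if_neg h0]
      simp [h0]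
      rintro rfl rfl
      exact h0 rfl
    · rw [crossMatrix_offDiag p (Ne.symm h)]
      by_cases h1 : i₀ = i
      · subst h1
        by_cases h2 : j₀ = j
        · subst h2
          simp [hw, h]
        · simp [h0, h2, Ne.symm h2]
      · simp [h0, h1, Ne.symm h1]

theorem matrix_ext_downUp {R : Type*}
    {M M' : Matrix (State N (.tensor .down .up)) (State N (.tensor .down .up)) R}
    (h : ∀ i j k l : Fin N, M (pair (ofDown i) (ofUp j)) (pair (ofDown k) (ofUp l)) =
      M' (pair (ofDown i) (ofUp j)) (pair (ofDown k) (ofUp l))) : M = M' := by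
  ext ⟨i, j⟩ ⟨k, l⟩
  exact h i j k l

theorem one_apply_downUp (i j k l : Fin N) :
    (1 : Matrix (State N (.tensor .down .up)) (State N (.tensor .down .up)) K)
      (pair (ofDown i) (ofUp j)) (pair (ofDown k) (ofUp l)) = if i = k ∧ j = l then 1 else 0 := by
  rw [Matrix.one_apply]
  simp only [pair_inj, ofDown_inj, ofUp_inj]

theorem rt_lock (hq : q ≠ 0) (p : Bool) :
    rt q N (lock p) = 1 + lockCoeff q N p • rt q N cupCap := by
  refine matrix_ext_downUp fun i j k l => ?_
  rw [rt_lock_apply hq, Matrix.add_apply, Matrix.smul_apply, one_apply_downUp, rt_cupCap_apply,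
    smul_eq_mul]

theorem rt_cupCap_mul_self :
    rt q N cupCap * rt q N cupCap = (∑ l : Fin N, weight q N l) • rt q N cupCap := by
  refine matrix_ext_downUp fun i j k l => ?_
  rw [Matrix.mul_apply, sum_tensor, Matrix.smul_apply]
  simp only [sum_up, sum_down, rt_cupCap_apply, ← sum_weight_inv, smul_eq_mul, Finset.sum_mul,
    ite_and]
  refine Finset.sum_congr rfl fun m _ => ?_
  simp only [mul_ite, ite_mul, mul_zero, zero_mul, Finset.sum_ite_eq, Finset.mem_univ, if_true]
  split_ifs <;> ring

theorem one_add_smul_cupCap_mul (a b : K) :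
    (1 + a • rt q N cupCap) * (1 + b • rt q N cupCap) =
      1 + (a + b + a * b * ∑ l : Fin N, weight q N l) • rt q N cupCap := by
  rw [add_mul, mul_add, mul_add, one_mul, one_mul, mul_one, smul_mul_smul_comm, rt_cupCap_mul_self,
    smul_smul, add_smul, add_smul]
  abel

theorem rt_apt_of_rt_chain {n : ℤ} (hq : q ≠ 0) {x : K}
    (hx : rt q N (chain n) = 1 + x • rt q N cupCap) :
    rt q N (apt n) () () =
      (∑ l : Fin N, weight q N l) * ((∑ l : Fin N, weight q N l) + x) := by
  change rt q N (apt n) star star = _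
  have hc : ∀ i j k l : Fin N,
      rt q N (chain n) (pair (ofDown i) (ofUp j)) (pair (ofDown k) (ofUp l)) =
      (if i = k ∧ j = l then 1 else 0) + x * (if i = j ∧ k = l then (weight q N i)⁻¹ else 0) := by
    intro i j k l
    rw [hx, Matrix.add_apply, Matrix.smul_apply, one_apply_downUp, rt_cupCap_apply, smul_eq_mul]
  rw [apt, rt_lunitInv_comp_apply, rt_comp_apply]
  simp only [sum_tensor, sum_up, sum_down, rt_tensor_apply, rt_cupUD_apply, mul_ite, mul_one,
    mul_zero, Finset.sum_ite_irrel, Finset.sum_const_zero, Finset.sum_ite_eq, Finset.mem_univ,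
    if_true]
  simp only [rt_comp_apply (middle _ _ _), sum_tensor, sum_up, sum_down, rt_comp_lunit_apply,
    rt_tensor_apply, rt_capUD_apply, ofUp_inj, ofDown_inj, rt_middle_apply, hc]
  have h1 : ∀ k l : Fin N, (∑ i₁, ∑ i₂, ∑ j₁, ∑ j₂,
      ((if i₁ = i₂ then weight q N i₁ else 0) * if j₁ = j₂ then weight q N j₁ else 0) *
        if i₁ = k ∧ j₂ = l then (if i₂ = k ∧ j₁ = l then 1 else 0) +
          x * if i₂ = j₁ ∧ k = l then (weight q N i₂)⁻¹ else 0 else 0) =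
      weight q N k * weight q N l + (if k = l then x * weight q N l else 0) := by
    intro k l
    rw [Finset.sum_eq_single k, Finset.sum_eq_single k, Finset.sum_eq_single l,
      Finset.sum_eq_single l]
    · have := weight_ne_zero hq l
      by_cases h : k = l
      · subst h
        simp
        field_simp
      · simp [h]
    all_goals simp +contextual [eq_comm]
  simp_rw [h1]
  simp only [Finset.sum_add_distrib, Finset.sum_ite_eq, Finset.mem_univ, if_true, mul_add,
    Finset.sum_mul, ← Finset.mul_sum, mul_comm x]

theorem rt_openClosure_of_rt_chain {n : ℤ} {x : K}
    (hx : rt q N (chain n) = 1 + x • rt q N cupCap) :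
    rt q N (openClosure n) () () =
      (∑ l : Fin N, weight q N l) * (1 + (∑ l : Fin N, weight q N l) * x) := by
  change rt q N (openClosure n) star star = _
  have hc : ∀ i j k l : Fin N,
      rt q N (chain n) (pair (ofDown i) (ofUp j)) (pair (ofDown k) (ofUp l)) =
      (if i = k ∧ j = l then 1 else 0) + x * (if i = j ∧ k = l then (weight q N i)⁻¹ else 0) := by
    intro i j k l
    rw [hx, Matrix.add_apply, Matrix.smul_apply, one_apply_downUp, rt_cupCap_apply, smul_eq_mul]
  rw [openClosure, rt_comp_apply]
  simp only [rt_comp_apply (chain n), sum_tensor, sum_up, sum_down, rt_cupDU_apply, rt_capDU_apply,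
    hc]
  have h1 : ∀ k l : Fin N, (∑ i : Fin N, ∑ j : Fin N, (if i = j then 1 else 0) *
      ((if i = k ∧ j = l then 1 else 0) + x * if i = j ∧ k = l then (weight q N i)⁻¹ else 0)) =
      if k = l then 1 + x * ∑ i : Fin N, weight q N i else 0 := by
    intro k l
    simp only [ite_mul, one_mul, zero_mul, Finset.sum_ite_eq, Finset.mem_univ, if_true, true_and,
      Finset.sum_add_distrib, ← Finset.mul_sum]
    by_cases h : k = l
    · subst h
      simp [sum_weight_inv]
    · have h2 : ∀ i, ¬ (i = k ∧ i = l) := by rintro i ⟨rfl, rfl⟩; exact h rfl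
      simp [h, h2]
  simp_rw [h1]
  simp only [ite_mul, mul_ite, mul_zero, zero_mul, Finset.sum_ite_eq, Finset.mem_univ,
    if_true, ← Finset.mul_sum, sum_weight_inv]
  ring

end LockOperator
end AntiparallelChain

namespace AntiparallelChain

section Recursion

variable {R S : Type*} [CommRing R] [CommRing S]

/-- The coefficient of cup-cap in a stack of `n` tangles with coefficient `f`, if a closed cycle has
the value `δ`. -/
def stackCoeff (f δ : R) : ℕ → R
  | 0 => 0
  | n + 1 => stackCoeff f δ n + f + stackCoeff f δ n * f * δ

theorem stackCoeff_mul (f δ : R) (n : ℕ) : stackCoeff f δ n * δ = (1 + f * δ) ^ n - 1 := by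
  induction n with
  | zero => simp [stackCoeff]
  | succ n ih =>
    rw [stackCoeff, pow_succ, ← sub_add_cancel ((1 + f * δ) ^ n) 1, ← ih]
    ring

theorem map_stackCoeff (g : R →+* S) (f δ : R) (n : ℕ) :
    g (stackCoeff f δ n) = stackCoeff (g f) (g δ) n := by
  induction n with
  | zero => simp [stackCoeff]
  | succ n ih => simp [stackCoeff, ih]

end Recursion

section ChainCoeff

variable {𝕂 : Type*} [Field 𝕂]

/-- The coefficient of cup-cap in a chain of `n` locks. -/
def chainCoeff (f δ : 𝕂) (n : ℤ) : 𝕂 := ((1 + f * δ) ^ n - 1) / δ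

variable {f f' δ : 𝕂}

theorem one_add_mul_one_add (h : f + f' + f * f' * δ = 0) : (1 + f * δ) * (1 + f' * δ) = 1 := by
  linear_combination δ * h

theorem one_add_eq_inv (h : f + f' + f * f' * δ = 0) : 1 + f' * δ = (1 + f * δ)⁻¹ :=
  eq_inv_of_mul_eq_one_right (one_add_mul_one_add h)

theorem one_add_ne_zero (h : f + f' + f * f' * δ = 0) : 1 + f * δ ≠ 0 :=
  left_ne_zero_of_mul_eq_one (one_add_mul_one_add h)

theorem ite_one_add_pow_natAbs (h : f + f' + f * f' * δ = 0) (n : ℤ) :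
    (1 + (if 0 ≤ n then f else f') * δ) ^ n.natAbs = (1 + f * δ) ^ n := by
  split_ifs with hn
  · rw [← zpow_natCast, Int.natAbs_of_nonneg hn]
  · rw [one_add_eq_inv h, inv_pow, ← zpow_natCast, ← zpow_neg]
    congr 1
    omega

theorem chainCoeff_zero : chainCoeff f δ 0 = 0 := by simp [chainCoeff]

theorem chainCoeff_one (hδ : δ ≠ 0) : chainCoeff f δ 1 = f := by simp [chainCoeff, hδ]

theorem chainCoeff_neg (h : f + f' + f * f' * δ = 0) (n : ℤ) :
    chainCoeff f δ (-n) = ((1 + f' * δ) ^ n - 1) / δ := by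
  rw [chainCoeff, one_add_eq_inv h, inv_zpow']

theorem chainCoeff_neg_one (hδ : δ ≠ 0) (h : f + f' + f * f' * δ = 0) :
    chainCoeff f δ (-1) = f' := by
  rw [chainCoeff_neg h]; simp [hδ]

theorem chainCoeff_add (hδ : δ ≠ 0) (h : f + f' + f * f' * δ = 0) (n m : ℤ) :
    chainCoeff f δ (n + m) =
      chainCoeff f δ n + chainCoeff f δ m + chainCoeff f δ n * chainCoeff f δ m * δ := by
  simp only [chainCoeff, zpow_add₀ (one_add_ne_zero h)]
  field_simp
  ring

theorem stackCoeff_natAbs (hδ : δ ≠ 0) (h : f + f' + f * f' * δ = 0) (n : ℤ) :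
    stackCoeff (if 0 ≤ n then f else f') δ n.natAbs = chainCoeff f δ n := by
  rw [chainCoeff, eq_div_iff hδ, stackCoeff_mul, ite_one_add_pow_natAbs h]

end ChainCoeff

theorem planar_chain_eq_iff {𝕂 : Type*} [Field 𝕂] {f f' δ : 𝕂} (hδ : δ ≠ 0)
    (h : f + f' + f * f' * δ = 0) (n : ℤ) (y : 𝕂) :
    (LockTangle.chain n).planar f f' δ =
      Finsupp.single LockTangle.vertical 1 + Finsupp.single LockTangle.horizontal y ↔
      y = chainCoeff f δ n := by
  rw [LockTangle.planar_chain n f f' hδ, ite_one_add_pow_natAbs h, add_right_inj,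
    (Finsupp.single_injective _).eq_iff, eq_comm]
  rfl

theorem rt_iter {K : Type*} [Field K] {q : K} {N : ℕ}
    {f : Diag (.tensor .down .up) (.tensor .down .up)} {x : K} (hf : rt q N f = 1 + x • rt q N cupCap) (n : ℕ) :
    rt q N (iter f n) =
      1 + stackCoeff x (∑ l : Fin N, weight q N l) n • rt q N cupCap := by
  induction n with
  | zero => simp [iter, stackCoeff, rt]
  | succ n ih =>
    change rt q N f * rt q N (iter f n) = _
    rw [hf, ih, one_add_smul_cupCap_mul, stackCoeff]
    ring_nf

theorem rt_chain {K : Type*} [Field K] {q : K} (hq : q ≠ 0) (N : ℕ) (n : ℤ) :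
    rt q N (chain n) = 1 + stackCoeff (lockCoeff q N (decide (0 ≤ n)))
      (∑ l : Fin N, weight q N l) n.natAbs • rt q N cupCap :=
  rt_iter (rt_lock hq _) _

theorem rt_cupCap_ne_zero {K : Type*} [Field K] {q : K} (hq : q ≠ 0) {N : ℕ} (hN : 1 ≤ N) :
    rt q N cupCap ≠ 0 := by
  intro h
  have h1 := rt_cupCap_apply (q := q) (⟨0, hN⟩ : Fin N) ⟨0, hN⟩ ⟨0, hN⟩ ⟨0, hN⟩
  rw [h] at h1
  simp only [Matrix.zero_apply, and_self, if_true] at h1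
  exact inv_ne_zero (weight_ne_zero hq _) h1.symm

/-! ### Lifts to Laurent polynomials -/

noncomputable section

open LaurentPolynomial

theorem ratFunc_X_pow_ne_one {n : ℕ} (hn : n ≠ 0) : (RatFunc.X : RatFunc ℚ) ^ n ≠ 1 := by
  intro h
  rw [← RatFunc.algebraMap_X, ← map_pow, ← map_one (algebraMap (Polynomial ℚ) (RatFunc ℚ))] at h
  have := congrArg Polynomial.natDegree (RatFunc.algebraMap_injective ℚ h)
  simp at this
  exact hn this

/-- `{q}` as an element of `ℚ(q)`. -/
def braceX : RatFunc ℚ := RatFunc.X - RatFunc.X⁻¹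

theorem braceX_ne_zero : braceX ≠ 0 := by
  intro h
  refine ratFunc_X_pow_ne_one (n := 2) two_ne_zero ?_
  rw [braceX, sub_eq_zero] at h
  rw [pow_two]
  nth_rewrite 2 [h]
  exact mul_inv_cancel₀ RatFunc.X_ne_zero

/-- `D` as a Laurent polynomial in `A`. -/
def laurentD : Laurent := (T 1 - T (-1)) * C braceX⁻¹

/-- `φ` or `φbar` as a Laurent polynomial in `A`. -/
def laurentφ (p : Bool) : Laurent := if p then T 1 * C braceX else -T (-1) * C braceX

/-- The coefficient of cup-cap in a chain of `n` locks, as a Laurent polynomial in `A`. -/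
def laurentChainCoeff (n : ℤ) : Laurent :=
  stackCoeff (laurentφ (decide (0 ≤ n))) laurentD n.natAbs

theorem spec_T (N : ℕ) (n : ℤ) : spec N (T n) = ((RatFunc.X : RatFunc ℚ) ^ N) ^ n := by
  simp [spec]

theorem spec_C (N : ℕ) (a : RatFunc ℚ) : spec N (C a) = a := by simp [spec]

theorem spec_laurentD (N : ℕ) :
    spec N laurentD = ∑ l : Fin N, weight (RatFunc.X : RatFunc ℚ) N l := by
  have h := sum_weight (N := N) (RatFunc.X_ne_zero : (RatFunc.X : RatFunc ℚ) ≠ 0)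
  rw [laurentD, map_mul, map_sub, spec_T, spec_T, spec_C, ← div_eq_mul_inv,
    div_eq_iff braceX_ne_zero, mul_comm, braceX, h, zpow_one, zpow_neg_one, zpow_neg, zpow_natCast]

theorem spec_laurentφ (N : ℕ) (p : Bool) :
    spec N (laurentφ p) = lockCoeff (RatFunc.X : RatFunc ℚ) N p := by
  cases p <;> simp [laurentφ, lockCoeff, spec_T, spec_C, braceX] <;> ring

theorem rt_chain_eq_spec (N : ℕ) (n : ℤ) :
    rt (RatFunc.X : RatFunc ℚ) N (chain n) =
      1 + spec N (laurentChainCoeff n) • rt RatFunc.X N cupCap := by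
  rw [rt_chain RatFunc.X_ne_zero, laurentChainCoeff, map_stackCoeff, spec_laurentD, spec_laurentφ]

theorem algebraMap_T (n : ℤ) : algebraMap Laurent RatQA (T n) = A ^ n := by
  have hnat : ∀ k : ℕ, algebraMap Laurent RatQA (T k) = A ^ k := fun k => by
    rw [A, ← map_pow, T_pow, mul_one]
  rcases Int.eq_nat_or_neg n with ⟨k, rfl | rfl⟩
  · rw [hnat, zpow_natCast]
  · rw [zpow_neg, zpow_natCast, ← hnat]
    refine eq_inv_of_mul_eq_one_left ?_
    rw [← map_mul, ← T_add, neg_add_cancel, T_zero, map_one]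

theorem A_ne_zero : A ≠ 0 := fun h => by
  have h1 := algebraMap_T 1
  have h2 : algebraMap Laurent RatQA (T 1 * T (-1)) = 1 := by
    rw [← T_add, add_neg_cancel, T_zero, map_one]
  rw [map_mul, h1, h, zpow_one, zero_mul] at h2
  exact zero_ne_one h2

/-- The embedding of `ℚ(q)` into the field of rational functions in `q` and `A`. -/
def embed : RatFunc ℚ →+* RatQA := (algebraMap Laurent RatQA).comp C

theorem embed_X : embed RatFunc.X = q := rfl

theorem q_ne_zero : q ≠ 0 := by
  rw [← embed_X]
  exact (map_ne_zero embed).2 RatFunc.X_ne_zero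

theorem embed_braceX : embed braceX = brace q := by
  rw [braceX, map_sub, map_inv₀, embed_X, brace]

theorem brace_q_ne_zero : brace q ≠ 0 := by
  rw [← embed_braceX]
  exact (map_ne_zero embed).2 braceX_ne_zero

theorem injective_algebraMap : Function.Injective (algebraMap Laurent RatQA) :=
  IsFractionRing.injective _ _

theorem A_sq_ne_embed (c : RatFunc ℚ) : A ^ 2 ≠ embed c := by
  intro h
  have h1 : (T 2 : Laurent) = C c := by
    refine injective_algebraMap ?_
    rw [algebraMap_T]
    exact_mod_cast h
  have h2 : ∀ N : ℕ, ((RatFunc.X : RatFunc ℚ) ^ N) ^ (2 : ℤ) = c := fun N => by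
    rw [← spec_T, h1, spec_C]
  have h3 : ((RatFunc.X : RatFunc ℚ) ^ 1) ^ (2 : ℤ) = (RatFunc.X ^ 0) ^ (2 : ℤ) :=
    (h2 1).trans (h2 0).symm
  refine ratFunc_X_pow_ne_one (n := 2) two_ne_zero ?_
  simpa using h3

theorem brace_ne_zero {x : RatQA} (hx : x ≠ 0) (h : x ^ 2 ≠ 1) : brace x ≠ 0 := by
  intro h0
  refine h ?_
  rw [brace, sub_eq_zero] at h0
  rw [pow_two]
  nth_rewrite 2 [h0]
  exact mul_inv_cancel₀ hx

theorem brace_A_ne_zero : brace A ≠ 0 :=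
  brace_ne_zero A_ne_zero fun h => A_sq_ne_embed 1 (by rw [h, map_one])

theorem brace_A_mul_q_ne_zero : brace (A * q) ≠ 0 := by
  refine brace_ne_zero (mul_ne_zero A_ne_zero q_ne_zero) fun h => A_sq_ne_embed (RatFunc.X⁻¹ ^ 2) ?_
  rw [map_pow, map_inv₀, embed_X, inv_pow]
  rw [mul_pow] at h
  exact eq_inv_of_mul_eq_one_left h

theorem brace_A_div_q_ne_zero : brace (A / q) ≠ 0 := by
  refine brace_ne_zero (div_ne_zero A_ne_zero q_ne_zero) fun h => A_sq_ne_embed (RatFunc.X ^ 2) ?_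
  rw [map_pow, embed_X]
  rw [div_pow] at h
  exact (div_eq_one_iff_eq (pow_ne_zero 2 q_ne_zero)).1 h

theorem D_ne_zero : D ≠ 0 := div_ne_zero brace_A_ne_zero brace_q_ne_zero

theorem algebraMap_C (c : RatFunc ℚ) : algebraMap Laurent RatQA (C c) = embed c := rfl

theorem algebraMap_laurentD : algebraMap Laurent RatQA laurentD = D := by
  rw [laurentD, map_mul, map_sub, algebraMap_T, algebraMap_T, algebraMap_C, map_inv₀, embed_braceX,
    zpow_one, zpow_neg_one, D, div_eq_mul_inv, show brace A = A - A⁻¹ from rfl]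

theorem algebraMap_laurentφ (p : Bool) :
    algebraMap Laurent RatQA (laurentφ p) = if p then φ else φbar := by
  cases p <;> simp [laurentφ, algebraMap_T, algebraMap_C, embed_braceX, φ, φbar] <;> ring

theorem φ_relation : φ + φbar + φ * φbar * D = 0 := by
  have h1 := A_ne_zero
  have h2 := brace_q_ne_zero
  rw [φ, φbar, D, show brace A = A - A⁻¹ from rfl]
  field_simp
  ring

theorem one_add_φ_mul_D : 1 + φ * D = A ^ 2 := by
  have h1 := A_ne_zero
  have h2 := brace_q_ne_zero
  rw [φ, D, show brace A = A - A⁻¹ from rfl]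
  field_simp
  ring

theorem algebraMap_laurentChainCoeff (n : ℤ) :
    algebraMap Laurent RatQA (laurentChainCoeff n) = chainCoeff φ D n := by
  rw [laurentChainCoeff, map_stackCoeff, algebraMap_laurentφ, algebraMap_laurentD,
    ← stackCoeff_natAbs D_ne_zero φ_relation]
  simp

theorem isFramedHomfly_iff {d : Diag .unit .unit} {p : Laurent}
    (hp : ∀ N : ℕ, 1 ≤ N → spec N p = rt (RatFunc.X : RatFunc ℚ) N d () ()) (P : RatQA) :
    IsFramedHomfly d P ↔ P = algebraMap Laurent RatQA p := by
  constructor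
  · rintro ⟨p', rfl, hp'⟩
    rw [eq_of_spec_eq fun N hN => (hp' N hN).trans (hp N hN).symm]
  · rintro rfl
    exact ⟨p, rfl, hp⟩

theorem isCupCapCoeff_chain_iff (n : ℤ) (x : RatQA) :
    IsCupCapCoeff (chain n) x ↔ x = chainCoeff φ D n := by
  rw [← algebraMap_laurentChainCoeff]
  constructor
  · rintro ⟨p, rfl, hp⟩
    congr 1
    refine eq_of_spec_eq fun N hN => ?_
    have h := (hp N hN).symm.trans (rt_chain_eq_spec N n)
    refine smul_left_injective _ (rt_cupCap_ne_zero RatFunc.X_ne_zero hN) (add_left_cancel h)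
  · rintro rfl
    exact ⟨_, rfl, fun N _ => rt_chain_eq_spec N n⟩

theorem isFramedHomfly_apt_iff (n : ℤ) (P : RatQA) : IsFramedHomfly (apt n) P ↔
    P = D * (D + chainCoeff φ D n) := by
  rw [← algebraMap_laurentChainCoeff, ← algebraMap_laurentD, ← map_add, ← map_mul]
  exact isFramedHomfly_iff (fun N _ => by
    rw [rt_apt_of_rt_chain RatFunc.X_ne_zero (rt_chain_eq_spec N n), map_mul, map_add,
      spec_laurentD]) P

theorem isFramedHomfly_openClosure_iff (n : ℤ) (P : RatQA) : IsFramedHomfly (openClosure n) P ↔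
    P = D * (1 + D * chainCoeff φ D n) := by
  rw [← algebraMap_laurentChainCoeff, ← algebraMap_laurentD, ← map_mul,
    ← map_one (algebraMap Laurent RatQA), ← map_add, ← map_mul]
  exact isFramedHomfly_iff (fun N _ => by
    rw [rt_openClosure_of_rt_chain (rt_chain_eq_spec N n), map_mul, map_add, map_mul, map_one,
      spec_laurentD]) P

theorem isHomfly_iff {d : Diag .unit .unit} {P₀ : RatQA}
    (h : ∀ P, IsFramedHomfly d P ↔ P = P₀) (H : RatQA) :
    IsHomfly d H ↔ H = A ^ (-writhe d) * P₀ := by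
  simp [IsHomfly, h]

theorem writhe_chain (n : ℤ) : writhe (chain n) = 2 * n := by
  have h1 : ∀ p, writhe (lock p) = if p then 2 else -2 := by
    intro p
    cases p <;> simp [lock, crossDU, crossUD, middle, writhe]
  have h2 : ∀ p k, writhe (iter (lock p) k) = k * writhe (lock p) := by
    intro p k
    induction k with
    | zero => simp [iter, writhe]
    | succ k ih => simp [iter, writhe, ih]; ring
  rw [chain, h2, h1]
  rcases le_total 0 n with hn | hn
  · obtain ⟨k, rfl⟩ := Int.eq_ofNat_of_zero_le hn
    simp [mul_comm]
  · obtain rfl | hn := hn.eq_or_lt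
    · simp
    · rw [if_neg (by simpa using hn), Int.natCast_natAbs, abs_of_neg hn]
      ring

theorem writhe_apt (n : ℤ) : writhe (apt n) = 2 * n := by
  simp [apt, middle, writhe, writhe_chain]

theorem writhe_openClosure (n : ℤ) : writhe (openClosure n) = 2 * n := by
  simp [openClosure, writhe, writhe_chain]

theorem isHomfly_apt_iff (n : ℤ) (H : RatQA) :
    IsHomfly (apt n) H ↔ H = A ^ (-2 * n) * (D ^ 2 - 1 + (1 + φ * D) ^ n) := by
  rw [isHomfly_iff (isFramedHomfly_apt_iff n), writhe_apt, chainCoeff, mul_add,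
    mul_div_cancel₀ _ D_ne_zero]
  ring_nf

theorem isHomfly_openClosure_iff (n : ℤ) (H : RatQA) :
    IsHomfly (openClosure n) H ↔ H = A ^ (-2 * n) * (D * (1 + φ * D) ^ n) := by
  rw [isHomfly_iff (isFramedHomfly_openClosure_iff n), writhe_openClosure, chainCoeff,
    mul_div_cancel₀ _ D_ne_zero, neg_mul, add_sub_cancel]

theorem isHomfly_openClosure_iff_eq_D (n : ℤ) (H : RatQA) :
    IsHomfly (openClosure n) H ↔ H = D := by
  rw [isHomfly_openClosure_iff, one_add_φ_mul_D, mul_left_comm, ← zpow_natCast, ← zpow_mul,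
    ← zpow_add₀ A_ne_zero, Nat.cast_ofNat, neg_mul, neg_add_cancel, zpow_zero, mul_one]

/-- The Laurent polynomials with integer coefficients. -/
abbrev integralLaurent : Subalgebra ℤ RatQA := Algebra.adjoin ℤ {q, q⁻¹, A, A⁻¹}

theorem zpow_sub_one_div_brace_mem (n : ℤ) : (A ^ (-2 * n) - 1) / brace A ∈ integralLaurent := by
  have hA : A ∈ integralLaurent := Algebra.subset_adjoin (by simp)
  have hA' : A⁻¹ ∈ integralLaurent := Algebra.subset_adjoin (by simp)
  have h0 := A_ne_zero
  have hb := brace_A_ne_zero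
  have hpos : ∀ k : ℕ, (A ^ (2 * k) - 1) / brace A ∈ integralLaurent := by
    intro k
    have : (A ^ (2 * k) - 1) / brace A = A * ∑ i ∈ Finset.range k, (A ^ 2) ^ i := by
      rw [div_eq_iff hb, pow_mul, ← geom_sum_mul, brace]
      field_simp
    rw [this]
    exact mul_mem hA (sum_mem fun i _ => pow_mem (pow_mem hA 2) i)
  rcases Int.eq_nat_or_neg n with ⟨k, rfl | rfl⟩
  · have : (A ^ (-2 * (k : ℤ)) - 1) / brace A =
        -(A⁻¹ ^ (2 * k) * ((A ^ (2 * k) - 1) / brace A)) := by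
      rw [neg_mul, zpow_neg, show (2 * (k : ℤ)) = ((2 * k : ℕ) : ℤ) by push_cast; rfl, zpow_natCast,
        inv_pow]
      field_simp
      ring
    rw [this]
    exact neg_mem (mul_mem (pow_mem hA' _) (hpos k))
  · rw [neg_mul_neg, show (2 * (k : ℤ)) = ((2 * k : ℕ) : ℤ) by push_cast; rfl, zpow_natCast]
    exact hpos k

theorem D_sq_sub_one : D ^ 2 - 1 = brace (A * q) * brace (A / q) / brace q ^ 2 := by
  have h1 := A_ne_zero
  have h2 := brace_q_ne_zero
  have h3 := q_ne_zero
  rw [D, eq_div_iff (pow_ne_zero 2 h2), sub_mul, div_pow, div_mul_cancel₀ _ (pow_ne_zero 2 h2)]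
  simp only [brace]
  field_simp
  ring

theorem isCyclotomicFunction_apt_iff {n : ℤ} {H : RatQA} (F : RatQA) (hH : IsHomfly (apt n) H) :
    IsCyclotomicFunction 2 H F ↔ F = (A ^ (-2 * n) - 1) / brace A := by
  have h1 := brace_A_ne_zero
  have h2 := brace_q_ne_zero
  have h3 := brace_A_mul_q_ne_zero
  have h4 := brace_A_div_q_ne_zero
  have key : H = D ^ 2 * (1 + brace (A * q) * brace (A / q) / brace A ^ (((2 : ℕ) : ℤ) - 1) * F) ↔
      F = (A ^ (-2 * n) - 1) / brace A := by
    have h5 : H = D ^ 2 + (D ^ 2 - 1) * (A ^ (-2 * n) - 1) := by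
      rw [(isHomfly_apt_iff n H).1 hH, one_add_φ_mul_D, mul_add, ← zpow_natCast A 2, ← zpow_mul,
        ← zpow_add₀ A_ne_zero, Nat.cast_ofNat, neg_mul, neg_add_cancel, zpow_zero]
      ring
    have h6 : D ^ 2 * (1 + brace (A * q) * brace (A / q) / brace A ^ (((2 : ℕ) : ℤ) - 1) * F) =
        D ^ 2 + (D ^ 2 - 1) * (brace A * F) := by
      rw [D_sq_sub_one, D, show (((2 : ℕ) : ℤ) - 1) = 1 by norm_num, zpow_one]
      field_simp
    have h7 : D ^ 2 - 1 ≠ 0 := by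
      rw [D_sq_sub_one]
      exact div_ne_zero (mul_ne_zero h3 h4) (pow_ne_zero 2 h2)
    rw [h5, h6, add_right_inj, mul_right_inj' h7, eq_div_iff h1, mul_comm F, eq_comm]
  rw [IsCyclotomicFunction, key]
  refine and_iff_right_of_imp ?_
  rintro rfl
  exact zpow_sub_one_div_brace_mem n

end

end AntiparallelChain

theorem mainTheorem4 :
    -- the planar calculus, for arbitrary weights
    (∀ (𝕂 : Type*) [Field 𝕂] (f f' δ : 𝕂), δ ≠ 0 → f + f' + f * f' * δ = 0 →
      ∃ Φ : ℤ → 𝕂,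
        (∀ (n : ℤ) (y : 𝕂), (LockTangle.chain n).planar f f' δ =
            Finsupp.single LockTangle.vertical 1 + Finsupp.single LockTangle.horizontal y ↔
          y = Φ n) ∧
        Φ 1 = f ∧ Φ 0 = 0 ∧ Φ (-1) = f' ∧
        (∀ n m : ℤ, Φ (n + m) = Φ n + Φ m + Φ n * Φ m * δ) ∧
        (∀ n : ℤ, Φ n = ((1 + f * δ) ^ n - 1) / δ) ∧
        (∀ n : ℤ, Φ (-n) = ((1 + f' * δ) ^ n - 1) / δ) ∧
        (∀ n : ℤ, (LockTangle.chain n).closedPolynomial LockTangle.joinSides f f' δ =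
          δ * (δ + Φ n)) ∧
        (∀ n : ℤ, (LockTangle.chain n).closedPolynomial LockTangle.joinHeights f f' δ =
          δ * (1 + δ * Φ n))) ∧
    -- the HOMFLY polynomial
    (φ + φbar + φ * φbar * D = 0 ∧
      ∃ Φ : ℤ → RatQA,
        (∀ (n : ℤ) (x : RatQA), IsCupCapCoeff (chain n) x ↔ x = Φ n) ∧
        Φ 1 = φ ∧ Φ 0 = 0 ∧ Φ (-1) = φbar ∧
        (∀ n m : ℤ, Φ (n + m) = Φ n + Φ m + Φ n * Φ m * D) ∧
        (∀ n : ℤ, Φ n = ((1 + φ * D) ^ n - 1) / D) ∧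
        (∀ n : ℤ, Φ (-n) = ((1 + φbar * D) ^ n - 1) / D) ∧
        (∀ (n : ℤ) (P : RatQA), IsFramedHomfly (apt n) P ↔ P = D * (D + Φ n)) ∧
        (∀ (n : ℤ) (P : RatQA), IsFramedHomfly (openClosure n) P ↔ P = D * (1 + D * Φ n)) ∧
        (∀ (n : ℤ) (H : RatQA), IsHomfly (apt n) H ↔
          H = A ^ (-2 * n) * (D ^ 2 - 1 + (1 + φ * D) ^ n)) ∧
        (∀ (n : ℤ) (H : RatQA), IsHomfly (openClosure n) H ↔
          H = A ^ (-2 * n) * (D * (1 + φ * D) ^ n)) ∧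
        (∀ (n : ℤ) (H : RatQA), IsHomfly (openClosure n) H ↔ H = D) ∧
        (∀ (n : ℤ) (H F : RatQA), IsHomfly (apt n) H →
          (IsCyclotomicFunction 2 H F ↔ F = (A ^ (-2 * n) - 1) / brace A))) := by
  refine ⟨fun 𝕂 _ f f' δ hδ h => ⟨chainCoeff f δ, planar_chain_eq_iff hδ h, chainCoeff_one hδ,
    chainCoeff_zero, chainCoeff_neg_one hδ h, chainCoeff_add hδ h, fun _ => rfl, chainCoeff_neg h,
    fun n => ?_, fun n => ?_⟩, φ_relation, chainCoeff φ D, isCupCapCoeff_chain_iff,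
    chainCoeff_one D_ne_zero, chainCoeff_zero, chainCoeff_neg_one D_ne_zero φ_relation,
    chainCoeff_add D_ne_zero φ_relation, fun _ => rfl, chainCoeff_neg φ_relation,
    isFramedHomfly_apt_iff, isFramedHomfly_openClosure_iff, isHomfly_apt_iff,
    isHomfly_openClosure_iff, isHomfly_openClosure_iff_eq_D,
    fun _ _ F hH => isCyclotomicFunction_apt_iff F hH⟩
  · rw [LockTangle.closedPolynomial_joinSides, ite_one_add_pow_natAbs h, mul_add, chainCoeff,
      mul_div_cancel₀ _ hδ, pow_two]
  · rw [LockTangle.closedPolynomial_joinHeights, ite_one_add_pow_natAbs h, chainCoeff,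
      mul_div_cancel₀ _ hδ, add_sub_cancel]
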